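/- **Setting.** Let $\mathcal G$ be a causal diagram (a DAG) with finitely many endogenous variables $\mathbf V$, each with a finite domain, and finitely many exogenous variables $\mathbf U$; write $\mathrm{pa}_V\subseteq\mathbf V$ and $U_V\subseteq\mathbf U$ for the sets of parents of $V$. For $U_i\in\mathbf U$ let $\mathbf C(U_i)$ be the c-component covering $U_i$, i.e. the set of endogenous variables connected to a child of $U_i$ by a path of bi-directed arrows ($V\leftrightarrow W$ if $V,W$ share an exogenous parent), let $d_i=\prod_V|\Omega_V|$ over all $V$ in $\mathbf C(U_i)$ or among the endogenous parents of its elements, and let $U_i$ take values in $\{1,\dots,K_i\}$, $K_i=d_i+1$. A model consists of a probability vector $q_i=P(U_i)$ for each $i$ (the $U_i$ being independent) and structural functions $f_V(\mathrm{pa}_V,u_V)$. The prior $\rho$ makes all $q_i$ and all function values $f_V(\mathrm{pa}_V,u_V)$ independent, with $q_i\sim\mathrm{Dirichlet}(\alpha_i,\dots,\alpha_i)$, $\alpha_i>0$, and with function values drawn from distributions that charge every element of $\Omega_V$ (e.g. uniform). Let $\mu=\mu(q,f)$ be a counterfactual measure: a finite linear combination of conditional probabilities of (possibly nested) counterfactual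 events, a conditional probability being set to $0$ in models where its condition has probability $0$. Let $\mathbf D=(V^1,\dots,V^T)$ be records that some structural causal model with diagram $\mathcal G$ can produce; that is, if $V$ has no exogenous parent, records that agree on $\mathrm{pa}_V$ agree on $V$. The posterior $P(\cdot\mid\mathbf D;\mathcal G,\rho)$ is the law of $(q,f)$, or of $\mu(q,f)$, given independent observations $\mathbf D$. **Procedure** $\mathrm{SampleCTF}(\mathbf D,\mathcal G,\mu)$ with burn-in $M$ and $N$ outputs. Initialize every $q_i$ as uniform, draw $f$ at random (from its prior), assign $U^1,\dots,U^T$ uniformly at random, and for $t=1,\dots,T$ change $f$ so that it maps $U^t$ to $V^t$. Then repeat $M+N$ rounds: (i) independently for each $t$ draw $U^t\sim P(U\mid V=V^t;q,f)$ (uniformly, if no value of $U$ gives $V^t$ positive probability); (ii) draw a fresh random $f$ and, for $t=1,\dots,T$, change it so that it maps $U^t$ to $V^t$; draw each $q_i$ from the Dirichlet distribution with parameters $\alpha_i+\#\{t:U_i^t=k\}$, $k=1,\dots,K_i$; (iii) in rounds $M+1,\dots,M+N$ output $\mu_{M+j}=\mu(q,f)$. **Theorem.** Given the priors $\rho$ over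 $P(\mathbf U)$ and the structural functions, $\mathrm{SampleCTF}$ draws posterior samples of $\mu$ given $\mathbf D$, in the following sense. 1. The data have positive prior probability, so that $P(\mu\mid\mathbf D;\mathcal G,\rho)$ is a well-defined probability distribution. 2. The posterior of $(q,f)$ is invariant under a round; if the initial $(q,f)$ has the posterior distribution, every output satisfies $\mu_{M+j}\sim P(\mu\mid\mathbf D;\mathcal G,\rho)$ exactly, for all $M,N$. 3. From the initialization of the procedure, the output is a well-defined random vector for all $M,N$, and the law of $\mu_{M+j}$ converges to $P(\mu\mid\mathbf D;\mathcal G,\rho)$ in total variation as $M\to\infty$, uniformly in $N$ and $1\le j\le N$. -/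

import Mathlib

open MeasureTheory ProbabilityTheory
open scoped ENNReal

/-- A causal diagram. The endogenous variables are the elements of `V`, the variable `v` having the
domain `Ω v`; the exogenous variables are the elements of `U`; `pa v` and `ex v` are the sets of
endogenous and of exogenous parents of `v`. -/
structure CausalDiagram {V : Type*} (Ω : V → Type*) (U : Type*) where
  pa : V → Finset V
  ex : V → Finset U
  acyclic : ∀ v, ¬ Relation.TransGen (fun p w => p ∈ pa w) v v

/-- Terms for (nested) counterfactual variables. `const x` is a constant value, and `resp y S g` is
the potential response of `y` when every `x ∈ S` is set to the value of the counterfactual variable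
`g x`. For example `Y_{a, W_{a'}}` is
`resp Y {A, W}` with `A` set to `const a` and `W` set to `resp W {A} (A set to const a')`. -/
inductive CtfTerm {V : Type*} (Ω : V → Type*) : V → Type _
  | const {v : V} (x : Ω v) : CtfTerm Ω v
  | resp (y : V) (S : Finset V) (g : (x : V) → x ∈ S → CtfTerm Ω x) : CtfTerm Ω y

/-- A counterfactual event: a finite conjunction of conditions `Y_{...} = y` on (possibly nested)
counterfactual variables. The empty list is the sure event. -/
abbrev CtfEvent {V : Type*} (Ω : V → Type*) : Type _ :=
  List ((v : V) × CtfTerm Ω v × Ω v)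

/-- A counterfactual measure: a finite linear combination `∑ c * P(E | B)` of conditional
probabilities of counterfactual events, given as a list of triples `(c, E, B)`.
The counterfactual, direct, indirect and spurious effects have this form with `c = 1` and
`c = -1`; an unconditional probability is the case `B = []`. -/
abbrev CtfMeasure {V : Type*} (Ω : V → Type*) : Type _ :=
  List (ℝ × CtfEvent Ω × CtfEvent Ω)

/-- The Dirichlet distribution with parameters `θ 0, …, θ n`: the probability measure on the simplex
`{x : 0 ≤ x k, ∑ x k = 1}` with density proportional to `∏ x k ^ (θ k - 1)` with respect to the
Lebesgue measure in the first `n` coordinates. -/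
noncomputable def dirichlet {n : ℕ} (θ : Fin (n + 1) → ℝ) : Measure (Fin (n + 1) → ℝ) :=
  let base : Measure (Fin (n + 1) → ℝ) :=
    ((volume : Measure (Fin n → ℝ)).restrict {y | (∀ k, 0 ≤ y k) ∧ ∑ k, y k ≤ 1}).map
      (fun y => Fin.snoc (α := fun _ => ℝ) y (1 - ∑ k, y k))
  let m := base.withDensity (fun x => ENNReal.ofReal (∏ k, x k ^ (θ k - 1)))
  (m Set.univ)⁻¹ • m

namespace CausalDiagram

theorem wf {V U : Type*} [Finite V] {Ω : V → Type*} (G : CausalDiagram Ω U) : WellFounded (fun p w => p ∈ G.pa w) := by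
  have : IsTrans V (Relation.TransGen (fun p w => p ∈ G.pa w)) := ⟨fun _ _ _ => .trans⟩
  have : Std.Irrefl (Relation.TransGen (fun p w => p ∈ G.pa w)) := ⟨G.acyclic⟩
  exact Subrelation.wf (fun h => Relation.TransGen.single h)
    (Finite.wellFounded_of_trans_of_irrefl (Relation.TransGen (fun p w => p ∈ G.pa w)))

variable {V U : Type*} [Fintype V] [DecidableEq V] [Fintype U] [DecidableEq U]
variable {Ω : V → Type*} [∀ v, Fintype (Ω v)] [∀ v, DecidableEq (Ω v)]

/-- A bi-directed arrow: two endogenous variables with a common exogenous parent. -/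
def BiArrow (G : CausalDiagram Ω U) (v w : V) : Prop := ∃ k, k ∈ G.ex v ∧ k ∈ G.ex w

open Classical in
/-- The c-component covering the exogenous variable `i`: all endogenous variables that are connected
to a child of `i` by a bi-directed path. -/
noncomputable def cComponent (G : CausalDiagram Ω U) (i : U) : Finset V :=
  Finset.univ.filter fun v => ∃ w, i ∈ G.ex w ∧ Relation.ReflTransGen G.BiArrow w v

/-- The number `d i = ∏ |V|` over the c-component covering `i` and its endogenous parents. -/
noncomputable def d (G : CausalDiagram Ω U) (i : U) : ℕ :=
  ∏ v ∈ G.cComponent i ∪ (G.cComponent i).biUnion G.pa, Fintype.card (Ω v)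

/-- Joint values of the exogenous variables; the exogenous variable `i` has `K i = d i + 1` states. -/
abbrev ExVal (G : CausalDiagram Ω U) : Type _ := (i : U) → Fin (G.d i + 1)

/-- Families of structural functions `f v (pa v, u v)`. -/
abbrev Fns (G : CausalDiagram Ω U) : Type _ :=
  (v : V) → ((p : G.pa v) → Ω p) → ((i : G.ex v) → Fin (G.d i + 1)) → Ω v

/-- Parameters of a structural causal model over `G`: a probability vector for every exogenous
variable, and the structural functions. -/
abbrev Params (G : CausalDiagram Ω U) : Type _ :=
  ((i : U) → Fin (G.d i + 1) → ℝ) × G.Fns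

/-- An assignment of exogenous values to the `T` records. -/
abbrev Config (G : CausalDiagram Ω U) (T : ℕ) : Type _ := Fin T → G.ExVal

/-- The solution of the submodel with structural functions `f` under the intervention `I`
(`I v = some x` sets `v` to `x`), given the exogenous values `u`. -/
noncomputable def solve (G : CausalDiagram Ω U) (f : G.Fns) (I : (v : V) → Option (Ω v))
    (u : G.ExVal) : (v : V) → Ω v :=
  G.wf.fix fun v ih =>
    match I v with
    | some x => x
    | none => f v (fun p => ih p.1 p.2) (fun i => u i.1)

/-- The values of the endogenous variables, without intervention. -/
noncomputable def obs (G : CausalDiagram Ω U) (f : G.Fns) (u : G.ExVal) : (v : V) → Ω v :=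
  G.solve f (fun _ => none) u

/-- The value of a (nested) counterfactual variable given the exogenous values `u`. -/
noncomputable def ctfEval (G : CausalDiagram Ω U) (f : G.Fns) (u : G.ExVal) :
    {v : V} → CtfTerm Ω v → Ω v
  | _, .const x => x
  | _, .resp y S g =>
      G.solve f (fun x => if h : x ∈ S then some (G.ctfEval f u (g x h)) else none) u y

/-- The counterfactual event `E` holds in the unit `u`. -/
def Holds (G : CausalDiagram Ω U) (f : G.Fns) (u : G.ExVal) (E : CtfEvent Ω) : Prop :=
  ∀ a ∈ E, G.ctfEval f u a.2.1 = a.2.2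

/-- The probability `P(u)`; the exogenous variables are mutually independent. -/
def exoProb (G : CausalDiagram Ω U) (θ : G.Params) (u : G.ExVal) : ℝ := ∏ i, θ.1 i (u i)

open Classical in
/-- The probability `∑ u, 1[E u] P(u)` of a set `E` of units. -/
noncomputable def prob (G : CausalDiagram Ω U) (θ : G.Params) (E : G.ExVal → Prop) : ℝ :=
  ∑ u, if E u then G.exoProb θ u else 0

/-- The value of a counterfactual measure in the model with parameters `θ`. A conditional
probability whose condition has probability zero counts as `0`. -/
noncomputable def ctfValue (G : CausalDiagram Ω U) (μ : CtfMeasure Ω) (θ : G.Params) : ℝ :=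
  (μ.map fun s => s.1 *
    (G.prob θ (fun u => G.Holds θ.2 u s.2.1 ∧ G.Holds θ.2 u s.2.2) /
      G.prob θ (fun u => G.Holds θ.2 u s.2.2))).sum

/-- The observational probability `P(V = x)` of a record `x`. -/
noncomputable def obsProb (G : CausalDiagram Ω U) (θ : G.Params) (x : (v : V) → Ω v) : ℝ :=
  G.prob θ (fun u => G.obs θ.2 u = x)

/-- A structural causal model over `G` can produce the records `D`: a variable without exogenous
parents is a function of its endogenous parents in them. (No condition if every endogenous variable
has an exogenous parent.) -/
def Possible (G : CausalDiagram Ω U) {T : ℕ} (D : Fin T → (v : V) → Ω v) : Prop :=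
  ∀ v, G.ex v = ∅ → ∀ s t, (∀ p ∈ G.pa v, D s p = D t p) → D s v = D t v

variable [∀ v, MeasurableSpace (Ω v)] [∀ v, DiscreteMeasurableSpace (Ω v)]

/-- Hyperparameters `ρ` of the prior: the vector `P(U i)` is `Dirichlet(α i, …, α i)`, and the values
`f v (p, e)` of the structural functions are drawn from the distributions `φ v p e`, which charge
every value (for example the uniform distributions); all these draws are independent. -/
structure Prior (G : CausalDiagram Ω U) where
  α : U → ℝ
  α_pos : ∀ i, 0 < α i
  φ : (v : V) → ((p : G.pa v) → Ω p) → ((i : G.ex v) → Fin (G.d i + 1)) → PMF (Ω v)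
  φ_pos : ∀ v p e x, φ v p e x ≠ 0

/-- The law of a random family of structural functions. -/
noncomputable def fnLaw (G : CausalDiagram Ω U) (ρ : G.Prior) : Measure G.Fns :=
  Measure.pi fun v => Measure.pi fun p => Measure.pi fun e => (ρ.φ v p e).toMeasure

/-- The prior distribution of the parameters. -/
noncomputable def priorLaw (G : CausalDiagram Ω U) (ρ : G.Prior) : Measure G.Params :=
  (Measure.pi fun i => dirichlet fun _ : Fin (G.d i + 1) => ρ.α i).prod (G.fnLaw ρ)

/-- The likelihood of independent records `D`. -/
noncomputable def likelihood (G : CausalDiagram Ω U) {T : ℕ} (D : Fin T → (v : V) → Ω v)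
    (θ : G.Params) : ℝ≥0∞ :=
  ENNReal.ofReal (∏ t, G.obsProb θ (D t))

/-- The prior probability of the data. -/
noncomputable def evidence (G : CausalDiagram Ω U) (ρ : G.Prior) {T : ℕ}
    (D : Fin T → (v : V) → Ω v) : ℝ≥0∞ :=
  ∫⁻ θ, G.likelihood D θ ∂(G.priorLaw ρ)

/-- The posterior distribution of the parameters given the data, by Bayes' rule. -/
noncomputable def posterior (G : CausalDiagram Ω U) (ρ : G.Prior) {T : ℕ}
    (D : Fin T → (v : V) → Ω v) : Measure G.Params :=
  (G.evidence ρ D)⁻¹ • (G.priorLaw ρ).withDensity (G.likelihood D)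

/-- The posterior distribution of the counterfactual measure `μ` given the data. -/
noncomputable def posteriorCtf (G : CausalDiagram Ω U) (ρ : G.Prior) {T : ℕ}
    (D : Fin T → (v : V) → Ω v) (μ : CtfMeasure Ω) : Measure ℝ :=
  (G.posterior ρ D).map (G.ctfValue μ)

/-! The sampling procedure. -/

/-- The conditional probability of `u` given the record `x`, proportional to `P(x | u) P(u)`. If `x`
has probability zero, so that this is undefined, `u` is assigned at random (uniformly), as in the
initialization. -/
noncomputable def condExo (G : CausalDiagram Ω U) (θ : G.Params) (x : (v : V) → Ω v)
    (u : G.ExVal) : ℝ :=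
  if G.obsProb θ x = 0 then (Fintype.card G.ExVal : ℝ)⁻¹
  else (if G.obs θ.2 u = x then G.exoProb θ u else 0) / G.obsProb θ x

/-- One update: change `f` so that `u` produces the record `x`. -/
noncomputable def updateFn (G : CausalDiagram Ω U) (x : (v : V) → Ω v) (u : G.ExVal) (f : G.Fns) : G.Fns :=
  fun v p e => if (∀ w, p w = x w) ∧ (∀ i, e i = u i) then x v else f v p e

/-- Update `f` to match the records `D` and the exogenous values `c`, record after record. -/
noncomputable def matchData (G : CausalDiagram Ω U) {T : ℕ} (D : Fin T → (v : V) → Ω v) (c : G.Config T)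
    (f : G.Fns) : G.Fns :=
  Fin.foldl T (fun g t => G.updateFn (D t) (c t) g) f

/-- The Dirichlet parameters: `α i` plus the number of occurrences of the state `k`. -/
noncomputable def counts (G : CausalDiagram Ω U) (ρ : G.Prior) {T : ℕ} (c : G.Config T) (i : U)
    (k : Fin (G.d i + 1)) : ℝ :=
  ρ.α i + (Finset.univ.filter fun t => c t i = k).card

/-- Given the exogenous values `c` of the records, draw new parameters: `P(U i)` from the Dirichlet
distribution with the updated parameters, and random structural functions, updated to match. -/
noncomputable def drawParams (G : CausalDiagram Ω U) (ρ : G.Prior) {T : ℕ}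
    (D : Fin T → (v : V) → Ω v) : Kernel (G.Config T) G.Params where
  toFun c := (Measure.pi fun i => dirichlet (G.counts ρ c i)).prod
    ((G.fnLaw ρ).map (G.matchData D c))
  measurable' := .of_discrete

set_option linter.unusedSectionVars false in
theorem measurable_prob (G : CausalDiagram Ω U) (E : G.Fns → G.ExVal → Prop) :
    Measurable fun θ : G.Params => G.prob θ (E θ.2) := by
  classical
  refine measurable_from_prod_countable_left fun f => ?_
  simp only [prob, exoProb]
  refine Finset.measurable_sum _ fun u _ => ?_
  split_ifs <;> fun_prop

theorem measurable_condExo (G : CausalDiagram Ω U) (x : (v : V) → Ω v) (u : G.ExVal) :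
    Measurable fun θ : G.Params => G.condExo θ x u := by
  have h := G.measurable_prob fun f u => G.obs f u = x
  refine Measurable.ite (measurableSet_eq_fun h measurable_const) measurable_const
    (Measurable.div ?_ h)
  refine measurable_from_prod_countable_left fun f => ?_
  simp only [exoProb]
  split_ifs <;> fun_prop

/-- Given the parameters, draw the exogenous values of the records independently from their
conditional distributions given the data. -/
noncomputable def drawExo (G : CausalDiagram Ω U) {T : ℕ} (D : Fin T → (v : V) → Ω v) :
    Kernel G.Params (G.Config T) where
  toFun θ := ∑ c, ENNReal.ofReal (∏ t, G.condExo θ (D t) (c t)) • Measure.dirac c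
  measurable' := by
    refine Measure.measurable_of_measurable_coe _ fun A _ => ?_
    simp only [Measure.coe_finsetSum, Measure.coe_smul, Finset.sum_apply, Pi.smul_apply,
      smul_eq_mul]
    refine Finset.measurable_sum _ fun c _ => Measurable.mul_const ?_ _
    exact (Finset.measurable_prod _ fun t _ => G.measurable_condExo (D t) (c t)).ennreal_ofReal

/-- One round of the sampler. -/
noncomputable def round (G : CausalDiagram Ω U) (ρ : G.Prior) {T : ℕ}
    (D : Fin T → (v : V) → Ω v) : Kernel G.Params G.Params :=
  G.drawParams ρ D ∘ₖ G.drawExo D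

/-- The law of the parameters after the initialization: uniform vectors `P(U i)`, and random
structural functions, updated to match the data with uniformly assigned exogenous values. -/
noncomputable def initLaw (G : CausalDiagram Ω U) (ρ : G.Prior) {T : ℕ}
    (D : Fin T → (v : V) → Ω v) : Measure G.Params :=
  ((PMF.uniformOfFintype (G.Config T)).toMeasure.prod (G.fnLaw ρ)).map fun z =>
    (fun i _ => ((G.d i + 1 : ℕ) : ℝ)⁻¹, G.matchData D z.1 z.2)

/-- The law of the parameters after `m` rounds started from the law `ν`. -/
noncomputable def afterRounds (G : CausalDiagram Ω U) (ρ : G.Prior) {T : ℕ}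
    (D : Fin T → (v : V) → Ω v) (ν : Measure G.Params) : ℕ → Measure G.Params
  | 0 => ν
  | m + 1 => (G.afterRounds ρ D ν m).bind (G.round ρ D)

/-- The law of the values of `μ` in the next `N` rounds, the current parameters being `θ`. -/
noncomputable def outputs (G : CausalDiagram Ω U) (ρ : G.Prior) {T : ℕ}
    (D : Fin T → (v : V) → Ω v) (μ : CtfMeasure Ω) :
    (N : ℕ) → G.Params → Measure (Fin N → ℝ)
  | 0, _ => Measure.dirac Fin.elim0
  | N + 1, θ => (G.round ρ D θ).bind fun θ' =>
      (G.outputs ρ D μ N θ').map (Fin.cons (α := fun _ => ℝ) (G.ctfValue μ θ'))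

/-- The law of the output `[μ_{M+1}, …, μ_{M+N}]` of `M + N` rounds, of which the first `M` are
burn-in, when the initial parameters have the law `ν`. -/
noncomputable def run (G : CausalDiagram Ω U) (ρ : G.Prior) {T : ℕ}
    (D : Fin T → (v : V) → Ω v) (μ : CtfMeasure Ω) (ν : Measure G.Params) (M N : ℕ) :
    Measure (Fin N → ℝ) :=
  (G.afterRounds ρ D ν M).bind (G.outputs ρ D μ N)

/-- The law of the output of the procedure `SampleCTF`. -/
noncomputable def sampleCTF (G : CausalDiagram Ω U) (ρ : G.Prior) {T : ℕ}
    (D : Fin T → (v : V) → Ω v) (μ : CtfMeasure Ω) (M N : ℕ) : Measure (Fin N → ℝ) :=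
  G.run ρ D μ (G.initLaw ρ D) M N

end CausalDiagram

/-! The procedure is a two-block Gibbs sampler on the joint law of `(q, f)` and the exogenous values
`c` of the records.

Invariance is conjugacy. The prior weighted by the joint probability of `c` and `D` is a multiple of
`drawParams c` (`exists_priorLaw_withDensity`): the monomial in `q` raises the Dirichlet parameters,
and conditioning the independent function values on matching the data fixes those at the arguments
that are hit. Summing over `c` restores the likelihood, so `posterior_bind_round` follows.

For convergence, the two half-steps are regrouped so that the chain runs on the finite set of
assignments `c` (`exoMatrix`). By Doeblin's argument it suffices that one aperiodic state is
reachable from everywhere. The target gives distinct labels to distinct restrictions of records to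
the scope of a c-component. From any `c`, even an incompatible one, one step leads to a compatible
assignment depending only on these restrictions (`exists_compat_localConfig`). Since `K i = d i + 1`
exceeds the number of restrictions, a spare label always exists, and the target is reached by
relabelings, each being one possible step because a single `f` matches the data before and after
(`joined_of_relabel`). Applying `drawParams` does not increase the distance, which transfers
convergence to the parameters and to `μ`. -/

/-! ### Convergence of finite Markov chains. -/

section MarkovConvergence

variable {X : Type*} [Fintype X]

/-- The row sum `r` is left free: `r = 1` gives monotonicity in time, `r = 1 - δ` gives Doeblin's
contraction. -/
theorem Matrix.sum_abs_vecMul_le (Q : Matrix X X ℝ) {r : ℝ} (hQ : ∀ i j, 0 ≤ Q i j)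
    (hr : ∀ i, ∑ j, Q i j = r) (w : X → ℝ) :
    ∑ j, |(Matrix.vecMul w Q) j| ≤ r * ∑ i, |w i| := by
  calc ∑ j, |(Matrix.vecMul w Q) j| ≤ ∑ j, ∑ i, |w i| * Q i j := by
        refine Finset.sum_le_sum fun j _ => ?_
        simp only [Matrix.vecMul, dotProduct]
        refine (Finset.abs_sum_le_sum_abs _ _).trans (le_of_eq ?_)
        exact Finset.sum_congr rfl fun i _ => by rw [abs_mul, abs_of_nonneg (hQ i j)]
    _ = r * ∑ i, |w i| := by
        rw [Finset.sum_comm, Finset.mul_sum]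
        exact Finset.sum_congr rfl fun i _ => by rw [← Finset.mul_sum, hr, mul_comm]

variable [DecidableEq X]

/-- Doeblin's contraction: a stochastic matrix with a column bounded below by `δ` contracts the
`ℓ¹` norm of vectors of total mass zero by the factor `1 - δ`. -/
theorem Matrix.sum_abs_vecMul_le_of_column (Q : Matrix X X ℝ) (hQ : ∀ i j, 0 ≤ Q i j)
    (hQ1 : ∀ i, ∑ j, Q i j = 1) (k : X) {δ : ℝ} (hk : ∀ i, δ ≤ Q i k) (w : X → ℝ)
    (hw : ∑ i, w i = 0) :
    ∑ j, |(Matrix.vecMul w Q) j| ≤ (1 - δ) * ∑ i, |w i| := by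
  -- Removing `δ` from column `k` keeps the entries nonnegative and lowers the row sums to `1 - δ`;
  -- it does not change the image of `w`, which has total mass zero.
  have h := Matrix.sum_abs_vecMul_le (Matrix.of fun i j => Q i j - if j = k then δ else 0)
    (r := 1 - δ)
    (fun i j => by
      rw [Matrix.of_apply]
      split_ifs with h
      · subst h; linarith [hk i]
      · linarith [hQ i j])
    (fun i => by simp [Finset.sum_sub_distrib, hQ1]) w
  refine le_trans (le_of_eq (Finset.sum_congr rfl fun j _ => ?_)) h
  simp only [Matrix.vecMul, dotProduct, Matrix.of_apply, mul_sub, Finset.sum_sub_distrib,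
    ← Finset.sum_mul, hw, zero_mul, sub_zero]

theorem Matrix.pow_nonneg_entries (P : Matrix X X ℝ) (hP : ∀ i j, 0 ≤ P i j) (n : ℕ) (i j : X) :
    0 ≤ (P ^ n) i j := by
  induction n generalizing i j with
  | zero => simp only [pow_zero, Matrix.one_apply]; split_ifs <;> simp
  | succ n ih =>
    rw [pow_succ, Matrix.mul_apply]
    exact Finset.sum_nonneg fun l _ => mul_nonneg (ih i l) (hP l j)

theorem Matrix.pow_sum_row (P : Matrix X X ℝ) (hP : ∀ i, ∑ j, P i j = 1) (n : ℕ) (i : X) :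
    ∑ j, (P ^ n) i j = 1 := by
  induction n generalizing i with
  | zero => simp [Matrix.one_apply]
  | succ n ih =>
    simp only [pow_succ, Matrix.mul_apply]
    rw [Finset.sum_comm]
    simp only [← Finset.mul_sum, hP, mul_one, ih]

theorem Matrix.exists_pow_pos_of_reflTransGen (P : Matrix X X ℝ) (hP : ∀ i j, 0 ≤ P i j) (k : X)
    (hk : 0 < P k k) (hreach : ∀ i, Relation.ReflTransGen (fun i j => 0 < P i j) i k) :
    ∃ n, ∀ i, 0 < (P ^ n) i k := by
  have step : ∀ i l m n, 0 < (P ^ m) i l → 0 < (P ^ n) l k → 0 < (P ^ (m + n)) i k := by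
    intro i l m n h1 h2
    rw [pow_add, Matrix.mul_apply]
    exact Finset.sum_pos' (fun j _ => mul_nonneg (P.pow_nonneg_entries hP _ _ _)
      (P.pow_nonneg_entries hP _ _ _)) ⟨l, Finset.mem_univ _, mul_pos h1 h2⟩
  have hex : ∀ i, ∃ n, 0 < (P ^ n) i k := by
    intro i
    induction hreach i using Relation.ReflTransGen.head_induction_on with
    | refl => exact ⟨0, by simp⟩
    | head h _ ih =>
      obtain ⟨n, hn⟩ := ih
      exact ⟨1 + n, step _ _ 1 n (by simpa using h) hn⟩
  have hkk : ∀ n, 0 < (P ^ n) k k := by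
    intro n
    induction n with
    | zero => simp
    | succ n ih => rw [add_comm]; exact step k k 1 n (by simpa using hk) ih
  choose n hn using hex
  -- The sum dominates every `n i`; the surplus time is spent in the loop at `k`.
  refine ⟨∑ i, n i, fun i => ?_⟩
  rw [← Nat.add_sub_cancel' (Finset.single_le_sum (fun _ _ => Nat.zero_le _) (Finset.mem_univ i) :
    n i ≤ ∑ i, n i)]
  exact step i k _ _ (hn i) (hkk _)

/-- Convergence of a finite Markov chain, uniformly in the initial distribution. -/
theorem Matrix.exists_sum_abs_vecMul_pow_sub_le (P : Matrix X X ℝ) (hP : ∀ i j, 0 ≤ P i j)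
    (hP1 : ∀ i, ∑ j, P i j = 1) (k : X) (hk : 0 < P k k)
    (hreach : ∀ i, Relation.ReflTransGen (fun i j => 0 < P i j) i k)
    (π : X → ℝ) (hπ1 : ∑ i, π i = 1) (hπ : Matrix.vecMul π P = π)
    (ν : X → ℝ) (hν1 : ∑ i, ν i = 1) {ε : ℝ} (hε : 0 < ε) :
    ∃ M₀ : ℕ, ∀ M ≥ M₀, ∑ j, |(Matrix.vecMul ν (P ^ M)) j - π j| ≤ ε := by
  obtain ⟨n, hn⟩ := P.exists_pow_pos_of_reflTransGen hP k hk hreach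
  obtain ⟨δ, hδ0, hδ1, hδ⟩ : ∃ δ : ℝ, 0 < δ ∧ δ ≤ 1 ∧ ∀ i, δ ≤ (P ^ n) i k := by
    have : Nonempty X := ⟨k⟩
    obtain ⟨i₀, hi₀⟩ := Finite.exists_min fun i => (P ^ n) i k
    exact ⟨min 1 ((P ^ n) i₀ k), lt_min one_pos (hn i₀), min_le_left _ _,
      fun i => (min_le_right _ _).trans (hi₀ i)⟩
  set w := ν - π with hw
  have hw0 : ∑ i, w i = 0 := by simp [hw, hν1, hπ1]
  have hsum : ∀ m, ∑ i, (Matrix.vecMul w (P ^ m)) i = 0 := by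
    intro m
    simp only [Matrix.vecMul, dotProduct]
    rw [Finset.sum_comm]
    simp only [← Finset.mul_sum, P.pow_sum_row hP1, mul_one, hw0]
  set a : ℕ → ℝ := fun m => ∑ j, |(Matrix.vecMul w (P ^ m)) j| with ha
  -- The contraction controls only multiples of `n`; monotonicity covers the times in between.
  have hanti : Antitone a := by
    refine antitone_nat_of_succ_le fun m => ?_
    have := Matrix.sum_abs_vecMul_le P hP hP1 (Matrix.vecMul w (P ^ m))
    rwa [Matrix.vecMul_vecMul, ← pow_succ, one_mul] at this
  have hcontr : ∀ m, a (m + n) ≤ (1 - δ) * a m := by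
    intro m
    have := Matrix.sum_abs_vecMul_le_of_column (P ^ n) (P.pow_nonneg_entries hP n)
      (P.pow_sum_row hP1 n) k hδ (Matrix.vecMul w (P ^ m)) (hsum m)
    rwa [Matrix.vecMul_vecMul, ← pow_add] at this
  have hgeom : ∀ l, a (l * n) ≤ (1 - δ) ^ l * a 0 := by
    intro l
    induction l with
    | zero => simp
    | succ l ih =>
      rw [Nat.succ_mul, pow_succ']
      calc a (l * n + n) ≤ (1 - δ) * a (l * n) := hcontr _
        _ ≤ (1 - δ) * ((1 - δ) ^ l * a 0) := mul_le_mul_of_nonneg_left ih (by linarith)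
        _ = _ := by ring
  have hlim : Filter.Tendsto (fun l : ℕ => (1 - δ) ^ l * a 0) Filter.atTop (nhds 0) := by
    simpa using (tendsto_pow_atTop_nhds_zero_of_lt_one (by linarith : (0 : ℝ) ≤ 1 - δ)
      (by linarith)).mul_const (a 0)
  obtain ⟨l, hl⟩ := (hlim.eventually (gt_mem_nhds hε)).exists
  refine ⟨l * n, fun M hM => ?_⟩
  have hπM : Matrix.vecMul π (P ^ M) = π := by
    clear hM
    induction M with
    | zero => simp
    | succ M ih => rw [pow_succ', ← Matrix.vecMul_vecMul, hπ, ih]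
  have hfin : ∑ j, |(Matrix.vecMul ν (P ^ M)) j - π j| = a M := by
    simp only [ha, hw, Matrix.sub_vecMul, hπM, Pi.sub_apply]
  rw [hfin]
  exact ((hanti hM).trans (hgeom l)).trans hl.le

end MarkovConvergence

/-! ### Relabelings of maps into a larger finite set. -/

section Relabel

/-- `Relabel a b`: the map `b` arises from `a` by moving a set of points, on which `a` is constant,
to a value outside the range of `a`. -/
def Relabel {Q K : Type*} (a b : Q → K) : Prop :=
  ∃ (W : Set Q) (k : K), (∀ x ∈ W, ∀ y ∈ W, a x = a y) ∧ k ∉ Set.range a ∧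
    (∀ x ∈ W, b x = k) ∧ ∀ x ∉ W, b x = a x

theorem exists_notMem_range_of_card_lt {Q K : Type*} [Fintype Q] [Fintype K]
    (h : Fintype.card Q < Fintype.card K) (a : Q → K) : ∃ k, k ∉ Set.range a := by
  by_contra hc
  push Not at hc
  exact absurd (Fintype.card_le_of_surjective a hc) (by omega)

/-- Every map into a larger finite type is turned into a given injection by relabelings. -/
theorem reflTransGen_relabel {Q K : Type*} [Fintype Q] [Fintype K]
    (h : Fintype.card Q < Fintype.card K) (a e : Q → K) (he : Function.Injective e) :
    Relation.ReflTransGen Relabel a e := by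
  classical
  suffices H : ∀ s : Finset Q, ∃ b, Relation.ReflTransGen Relabel a b ∧ ∀ x ∈ s, b x = e x by
    obtain ⟨b, hb, hbe⟩ := H Finset.univ
    rwa [show b = e from funext fun x => hbe x (Finset.mem_univ _)] at hb
  intro s
  induction s using Finset.induction_on with
  | empty => exact ⟨a, .refl, by simp⟩
  | insert q s hq ih =>
    obtain ⟨b, hb, hbe⟩ := ih
    obtain ⟨k, hk⟩ := exists_notMem_range_of_card_lt h b
    -- The label `e q` is first vacated by moving its fibre to the spare label `k`; then `q` alone
    -- can move to `e q`. Points of `s` are unaffected since `e` is injective.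
    have h1 : Relabel b (fun x => if b x = e q then k else b x) :=
      ⟨{x | b x = e q}, k, fun x hx y hy => hx.trans hy.symm, hk, fun x hx => if_pos hx,
        fun x hx => if_neg hx⟩
    have h2 : Relabel (fun x => if b x = e q then k else b x)
        (Function.update (fun x => if b x = e q then k else b x) q (e q)) := by
      refine ⟨{q}, e q, by simp, ?_, by simp, fun x hx => Function.update_of_ne hx _ _⟩
      rintro ⟨x, hx⟩
      dsimp only at hx
      split_ifs at hx with hxq
      · exact hk ⟨x, hxq.trans hx.symm⟩
      · exact hxq hx
    refine ⟨_, (hb.tail h1).tail h2, fun x hx => ?_⟩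
    by_cases hxq : x = q
    · simp [hxq]
    · have hxs : x ∈ s := (Finset.mem_insert.1 hx).resolve_left hxq
      rw [Function.update_of_ne hxq, hbe x hxs, if_neg fun hc => hxq (he hc)]

/-- A relabeling can split fibres but never merges two of them, since the moved points come from one
fibre and the new label is unused. Together with `Relabel.eq_of_eq_left` this excludes new clashes
between old and new labels. -/
theorem Relabel.eq_of_eq {Q K : Type*} {a b : Q → K} (h : Relabel a b) {x y : Q}
    (hxy : b x = b y) : a x = a y := by
  obtain ⟨W, k, hW, hk, hbW, hb⟩ := h
  by_cases hx : x ∈ W <;> by_cases hy : y ∈ W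
  · exact hW x hx y hy
  · rw [hbW x hx, hb y hy] at hxy
    exact absurd ⟨y, hxy.symm⟩ hk
  · rw [hb x hx, hbW y hy] at hxy
    exact absurd ⟨x, hxy⟩ hk
  · rwa [hb x hx, hb y hy] at hxy

theorem Relabel.eq_of_eq_left {Q K : Type*} {a b : Q → K} (h : Relabel a b) {x y : Q}
    (hxy : a x = b y) : a x = a y := by
  obtain ⟨W, k, hW, hk, hbW, hb⟩ := h
  by_cases hy : y ∈ W
  · rw [hbW y hy] at hxy
    exact absurd ⟨x, hxy⟩ hk
  · rwa [hb y hy] at hxy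

/-- A map into a larger finite type can be changed off the set `p` so that it becomes injective
there and avoids the values taken elsewhere. -/
theorem exists_injective_off {Q K : Type*} [Fintype Q] [Fintype K]
    (h : Fintype.card Q ≤ Fintype.card K) (p : Q → Prop) (a : Q → K) :
    ∃ b : Q → K, (∀ x, p x → b x = a x) ∧ ∀ x y, ¬ p x → b x = b y → x = y := by
  classical
  let I : Finset K := (Finset.univ.filter p).image a
  -- The labels used on `p` number at most the points of `p`, so enough labels remain for the other
  -- points.
  have hI : I.card ≤ (Finset.univ.filter p).card := Finset.card_image_le
  have hcard : Fintype.card {x // ¬ p x} ≤ Fintype.card {k // k ∉ I} := by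
    rw [Fintype.card_subtype, Fintype.card_subtype]
    have h1 := Finset.card_filter_add_card_filter_not (s := (Finset.univ : Finset Q)) p
    have h2 := Finset.card_filter_add_card_filter_not (s := (Finset.univ : Finset K)) (· ∈ I)
    have h3 : Finset.univ.filter (· ∈ I) = I := by ext; simp
    rw [h3] at h2
    rw [Finset.card_univ] at h1 h2
    omega
  obtain ⟨e⟩ := Function.Embedding.nonempty_of_card_le hcard
  refine ⟨fun x => if hx : p x then a x else e ⟨x, hx⟩, fun x hx => dif_pos hx, ?_⟩
  intro x y hx hxy
  simp only [dif_neg hx] at hxy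
  split_ifs at hxy with hy
  · exact absurd (hxy ▸ Finset.mem_image_of_mem a (by simpa using hy)) (e ⟨x, hx⟩).2
  · exact congrArg Subtype.val (e.injective (Subtype.ext hxy))

end Relabel

/-! ### Functions matching the data and compatible exogenous values. -/

namespace CausalDiagram

variable {V U : Type*} [Fintype V] [DecidableEq V] [Fintype U] [DecidableEq U]
variable {Ω : V → Type*} [∀ v, Fintype (Ω v)] [∀ v, DecidableEq (Ω v)]

set_option linter.unusedSectionVars false

theorem obs_apply (G : CausalDiagram Ω U) (f : G.Fns) (u : G.ExVal) (v : V) :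
    G.obs f u v = f v (fun p => G.obs f u p) (fun i => u i) := by
  rw [obs, solve, WellFounded.fix_eq]

/-- Acyclicity makes the solution of the structural equations unique. Matching a record thus becomes
a condition on single values of `f`, which is independent across arguments under the prior. -/
theorem obs_eq_iff (G : CausalDiagram Ω U) (f : G.Fns) (u : G.ExVal) (x : (v : V) → Ω v) :
    G.obs f u = x ↔ ∀ v, f v (fun p => x p) (fun i => u i) = x v := by
  constructor
  · rintro rfl v
    exact (G.obs_apply f u v).symm
  · intro h
    funext v
    induction v using G.wf.induction with
    | _ v ih =>
      rw [obs_apply, ← h v]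
      congr 1
      funext p
      exact ih p.1 p.2

/-- The functions `f` map the exogenous values `c` of the records to the records `D`. -/
def Matches (G : CausalDiagram Ω U) {ι : Type*} (D : ι → (v : V) → Ω v) (c : ι → G.ExVal)
    (f : G.Fns) : Prop := ∀ t, G.obs f (c t) = D t

/-- The argument `(p, e)` of `f v` is the one determined by the record `x` in the unit `u`. -/
def Hits (G : CausalDiagram Ω U) (x : (v : V) → Ω v) (u : G.ExVal) (v : V)
    (p : (w : G.pa v) → Ω w) (e : (i : G.ex v) → Fin (G.d i + 1)) : Prop :=
  (∀ w, p w = x w) ∧ ∀ i, e i = u i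

theorem Matches.eq_of_hits {G : CausalDiagram Ω U} {ι : Type*} {D : ι → (v : V) → Ω v}
    {c : ι → G.ExVal} {f : G.Fns} (h : G.Matches D c f) {t : ι} {v : V}
    {p : (w : G.pa v) → Ω w} {e : (i : G.ex v) → Fin (G.d i + 1)} (ht : G.Hits (D t) (c t) v p e) :
    f v p e = D t v := by
  rw [← (G.obs_eq_iff f (c t) (D t)).1 (h t) v, funext ht.1, funext ht.2]

theorem matches_of_hits (G : CausalDiagram Ω U) {ι : Type*} {D : ι → (v : V) → Ω v}
    {c : ι → G.ExVal} {f : G.Fns} (h : ∀ t v p e, G.Hits (D t) (c t) v p e → f v p e = D t v) :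
    G.Matches D c f :=
  fun t => (G.obs_eq_iff _ _ _).2 fun v => h t v _ _ ⟨fun _ => rfl, fun _ => rfl⟩

/-- Later updates overwrite earlier ones. No compatibility is assumed, so the value at a hit
argument is only known to come from some record that hits it. -/
theorem matchData_apply (G : CausalDiagram Ω U) {T : ℕ} (D : Fin T → (v : V) → Ω v)
    (c : G.Config T) (f : G.Fns) (v : V) (p : (w : G.pa v) → Ω w)
    (e : (i : G.ex v) → Fin (G.d i + 1)) :
    (∃ t, G.Hits (D t) (c t) v p e ∧ G.matchData D c f v p e = D t v) ∨
      ((∀ t, ¬ G.Hits (D t) (c t) v p e) ∧ G.matchData D c f v p e = f v p e) := by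
  induction T with
  | zero => exact Or.inr ⟨fun t => t.elim0, by simp [matchData]⟩
  | succ T ih =>
    have hs : G.matchData D c f = G.updateFn (D (Fin.last T)) (c (Fin.last T))
        (G.matchData (fun t => D t.castSucc) (fun t => c t.castSucc) f) := by
      simp [matchData, Fin.foldl_succ_last]
    rw [hs]
    by_cases hl : G.Hits (D (Fin.last T)) (c (Fin.last T)) v p e
    · exact Or.inl ⟨Fin.last T, hl, if_pos hl⟩
    · have hu : ∀ g : G.Fns, G.updateFn (D (Fin.last T)) (c (Fin.last T)) g v p e = g v p e :=
        fun g => if_neg hl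
      rw [hu]
      rcases ih (fun t => D t.castSucc) (fun t => c t.castSucc) with ⟨t, ht, h⟩ | ⟨ht, h⟩
      · exact Or.inl ⟨t.castSucc, ht, h⟩
      · exact Or.inr ⟨fun t => Fin.lastCases hl ht t, h⟩

/-- Units and records are compatible: they are produced by a common family of functions. -/
def Compat (G : CausalDiagram Ω U) {ι : Type*} (D : ι → (v : V) → Ω v) (c : ι → G.ExVal) : Prop :=
  ∀ v s t, (∀ p ∈ G.pa v, D s p = D t p) → (∀ i ∈ G.ex v, c s i = c t i) → D s v = D t v

theorem Matches.compat {G : CausalDiagram Ω U} {ι : Type*} {D : ι → (v : V) → Ω v}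
    {c : ι → G.ExVal} {f : G.Fns} (h : G.Matches D c f) : G.Compat D c := by
  intro v s t hp hi
  rw [← h.eq_of_hits (t := s) (v := v) ⟨fun _ => rfl, fun _ => rfl⟩]
  exact h.eq_of_hits ⟨fun w => hp w w.2, fun i => hi i i.2⟩

theorem Compat.eq_of_hits {G : CausalDiagram Ω U} {ι : Type*} {D : ι → (v : V) → Ω v}
    {c : ι → G.ExVal} (h : G.Compat D c) {s t : ι} {v : V} {p : (w : G.pa v) → Ω w}
    {e : (i : G.ex v) → Fin (G.d i + 1)} (hs : G.Hits (D s) (c s) v p e)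
    (ht : G.Hits (D t) (c t) v p e) : D s v = D t v :=
  h v s t (fun w hw => (hs.1 ⟨w, hw⟩).symm.trans (ht.1 ⟨w, hw⟩))
    fun i hi => (hs.2 ⟨i, hi⟩).symm.trans (ht.2 ⟨i, hi⟩)

/-- Compatibility says that records hitting the same argument prescribe the same value, so any of
them may be chosen. The index type is arbitrary so that two assignments can be matched at once,
indexed by a sum type. -/
theorem Compat.exists_matches {G : CausalDiagram Ω U} {ι : Type*} {D : ι → (v : V) → Ω v}
    {c : ι → G.ExVal} (h : G.Compat D c) (f : G.Fns) : ∃ g, G.Matches D c g := by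
  classical
  refine ⟨fun v p e => if ht : ∃ t, G.Hits (D t) (c t) v p e then D ht.choose v else f v p e,
    G.matches_of_hits fun t v p e ht => ?_⟩
  have hex : ∃ t, G.Hits (D t) (c t) v p e := ⟨t, ht⟩
  rw [dif_pos hex]
  exact h.eq_of_hits hex.choose_spec ht

theorem Compat.matches_matchData {G : CausalDiagram Ω U} {T : ℕ} {D : Fin T → (v : V) → Ω v}
    {c : G.Config T} (h : G.Compat D c) (f : G.Fns) : G.Matches D c (G.matchData D c f) := by
  refine G.matches_of_hits fun t v p e ht => ?_
  rcases G.matchData_apply D c f v p e with ⟨s, hs, hsv⟩ | ⟨hn, _⟩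
  · rw [hsv, h.eq_of_hits hs ht]
  · exact absurd ht (hn t)

theorem Matches.matchData_eq {G : CausalDiagram Ω U} {T : ℕ} {D : Fin T → (v : V) → Ω v}
    {c : G.Config T} {f : G.Fns} (h : G.Matches D c f) : G.matchData D c f = f := by
  funext v p e
  rcases G.matchData_apply D c f v p e with ⟨s, hs, hsv⟩ | ⟨_, hf⟩
  · rw [hsv, h.eq_of_hits hs]
  · exact hf

/-! Connectedness of the compatible assignments. -/

/-- The variables of a c-component and their endogenous parents. -/
def scope (G : CausalDiagram Ω U) (C : Finset V) : Finset V := C ∪ C.biUnion G.pa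

theorem mem_scope (G : CausalDiagram Ω U) {C : Finset V} {v : V} (hv : v ∈ C) : v ∈ G.scope C :=
  Finset.mem_union_left _ hv

theorem pa_mem_scope (G : CausalDiagram Ω U) {C : Finset V} {v p : V} (hv : v ∈ C)
    (hp : p ∈ G.pa v) : p ∈ G.scope C :=
  Finset.mem_union_right _ (Finset.mem_biUnion.2 ⟨v, hv, hp⟩)

/-- The restrictions of records to the scope of the c-component covering `i`. -/
abbrev Local (G : CausalDiagram Ω U) (i : U) : Type _ :=
  (v : G.scope (G.cComponent i)) → Ω v

theorem card_local (G : CausalDiagram Ω U) (i : U) : Fintype.card (G.Local i) = G.d i := by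
  rw [Fintype.card_pi, d, scope, Finset.prod_coe_sort _ fun v => Fintype.card (Ω v)]

/-- The extra state in `K i = d i + 1` provides the spare label that relabelings need. -/
theorem card_local_lt (G : CausalDiagram Ω U) (i : U) :
    Fintype.card (G.Local i) < Fintype.card (Fin (G.d i + 1)) := by
  rw [card_local, Fintype.card_fin]
  exact Nat.lt_succ_self _

theorem mem_cComponent_iff (G : CausalDiagram Ω U) {i : U} {v w : V} (hi : i ∈ G.ex v) :
    w ∈ G.cComponent i ↔ Relation.ReflTransGen G.BiArrow v w := by
  classical
  simp only [cComponent, Finset.mem_filter, Finset.mem_univ, true_and]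
  exact ⟨fun ⟨w', hw', h⟩ => .head ⟨i, hi, hw'⟩ h, fun h => ⟨v, hi, h⟩⟩

theorem mem_cComponent (G : CausalDiagram Ω U) {i : U} {v : V} (hi : i ∈ G.ex v) :
    v ∈ G.cComponent i :=
  (G.mem_cComponent_iff hi).2 .refl

/-- Hence all exogenous parents of `v` are labelled by the same restriction of a record. -/
theorem cComponent_eq (G : CausalDiagram Ω U) {i j : U} {v : V} (hi : i ∈ G.ex v)
    (hj : j ∈ G.ex v) : G.cComponent i = G.cComponent j := by
  ext w
  rw [G.mem_cComponent_iff hi, G.mem_cComponent_iff hj]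

/-- The assignment of exogenous values in which the value of `i` is a function of the record
restricted to the scope of the c-component covering `i`. -/
def localConfig (G : CausalDiagram Ω U) {ι : Type*} (D : ι → (v : V) → Ω v)
    (b : (i : U) → G.Local i → Fin (G.d i + 1)) : ι → G.ExVal :=
  fun t i => b i fun v => D t v

/-- Equal labels at one exogenous parent of `v` force equal restrictions, which include the value of
`v`; `Possible` covers the variables without exogenous parents. -/
theorem compat_localConfig_of_injective {G : CausalDiagram Ω U} {T : ℕ}
    {D : Fin T → (v : V) → Ω v} (hD : G.Possible D) {b : (i : U) → G.Local i → Fin (G.d i + 1)}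
    (hb : ∀ i, Function.Injective (b i)) : G.Compat D (G.localConfig D b) := by
  intro v s t hp hi
  rcases (G.ex v).eq_empty_or_nonempty with h0 | ⟨i, hiv⟩
  · exact hD v h0 s t hp
  · exact congrFun (hb i (hi i hiv)) ⟨v, G.mem_scope (G.mem_cComponent hiv)⟩

/-- The unit `u` produces the values `q` in the c-component `C`. -/
def LocalObs (G : CausalDiagram Ω U) (f : G.Fns) (C : Finset V) (q : (v : G.scope C) → Ω v)
    (u : G.ExVal) : Prop :=
  ∀ v (hv : v ∈ C), f v (fun p => q ⟨p, G.pa_mem_scope hv p.2⟩) (fun i => u i) =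
    q ⟨v, G.mem_scope hv⟩

theorem localObs_of_obs_eq {G : CausalDiagram Ω U} {f : G.Fns} {u : G.ExVal} {x : (v : V) → Ω v}
    (h : G.obs f u = x) (C : Finset V) : G.LocalObs f C (fun v => x v) u :=
  fun v _ => (G.obs_eq_iff f u x).1 h v

/-- For functions `f` that agree with the data at the variables without exogenous parents, there is
a compatible assignment which `f` maps to every record that it can produce at all. -/
theorem exists_compat_localConfig {G : CausalDiagram Ω U} {T : ℕ} {D : Fin T → (v : V) → Ω v}
    (hD : G.Possible D) (f : G.Fns)
    (hf : ∀ v, G.ex v = ∅ → ∀ t e, f v (fun p => D t p) e = D t v) :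
    ∃ b, G.Compat D (G.localConfig D b) ∧
      ∀ t, G.obs f (G.localConfig D b t) = D t ∨ ∀ u, G.obs f u ≠ D t := by
  classical
  have : Nonempty G.ExVal := ⟨fun _ => 0⟩
  -- A restriction that `f` can produce takes its label from a chosen unit producing it; every other
  -- restriction gets a label of its own.
  have hb : ∀ i, ∃ b : G.Local i → Fin (G.d i + 1),
      (∀ q, (∃ u, G.LocalObs f (G.cComponent i) q u) →
        b q = Classical.epsilon (G.LocalObs f (G.cComponent i) q) i) ∧
      ∀ q r, ¬ (∃ u, G.LocalObs f (G.cComponent i) q u) → b q = b r → q = r :=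
    fun i => exists_injective_off (G.card_local_lt i).le _ _
  choose b hb1 hb2 using hb
  -- The exogenous parents of `v` share a c-component, so their labels are coordinates of one and
  -- the same chosen unit.
  have key : ∀ v t i, i ∈ G.ex v →
      (∃ u, G.LocalObs f (G.cComponent i) (fun w => D t w) u) →
      f v (fun p => D t p) (fun j => G.localConfig D b t j) = D t v := by
    intro v t i hi hu
    have h1 := Classical.epsilon_spec hu v (G.mem_cComponent hi)
    refine Eq.trans ?_ h1
    congr 1
    funext j
    have hC : G.cComponent j = G.cComponent i := G.cComponent_eq j.2 hi
    have hu' : ∃ u, G.LocalObs f (G.cComponent j) (fun w => D t w) u := by rw [hC]; exact hu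
    rw [localConfig, hb1 j _ hu']
    exact congrArg (fun C => Classical.epsilon (G.LocalObs f C fun w => D t w) j.1) hC
  refine ⟨b, fun v s t hp hi => ?_, fun t => ?_⟩
  · rcases (G.ex v).eq_empty_or_nonempty with h0 | ⟨i, hiv⟩
    · exact hD v h0 s t hp
    have hm := G.mem_scope (G.mem_cComponent hiv)
    by_cases hs : ∃ u, G.LocalObs f (G.cComponent i) (fun w => D s w) u
    · by_cases ht : ∃ u, G.LocalObs f (G.cComponent i) (fun w => D t w) u
      · rw [← key v s i hiv hs, ← key v t i hiv ht]
        congr 1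
        · funext p; exact hp p p.2
        · funext j; exact hi j j.2
      · exact (congrFun (hb2 i _ _ ht (hi i hiv).symm) ⟨v, hm⟩).symm
    · exact congrFun (hb2 i _ _ hs (hi i hiv)) ⟨v, hm⟩
  · by_cases hu : ∃ u, G.obs f u = D t
    · obtain ⟨u, hu⟩ := hu
      refine Or.inl ((G.obs_eq_iff _ _ _).2 fun v => ?_)
      rcases (G.ex v).eq_empty_or_nonempty with h0 | ⟨i, hiv⟩
      · exact hf v h0 t _
      · exact key v t i hiv ⟨u, localObs_of_obs_eq hu _⟩
    · exact Or.inr fun u h => hu ⟨u, h⟩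

/-- Two assignments that a common family of functions maps to the data. -/
def Joined (G : CausalDiagram Ω U) {ι : Type*} (D : ι → (v : V) → Ω v) (c c' : ι → G.ExVal) :
    Prop :=
  ∃ g, G.Matches D c g ∧ G.Matches D c' g

/-- Any coincidence of labels, within `b'` or between `b` and `b'`, is already one within `b`. So
the data listed twice, once with each assignment, remain compatible. -/
theorem joined_of_relabel {G : CausalDiagram Ω U} (f : G.Fns) {ι : Type*} {D : ι → (v : V) → Ω v}
    {b b' : (i : U) → G.Local i → Fin (G.d i + 1)} (hb : G.Compat D (G.localConfig D b))
    (h : ∀ i, b i = b' i ∨ Relabel (b i) (b' i)) :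
    G.Joined D (G.localConfig D b) (G.localConfig D b') := by
  have h1 : ∀ i q r, b' i q = b' i r → b i q = b i r := fun i q r hqr => by
    rcases h i with h | h
    · rwa [h]
    · exact h.eq_of_eq hqr
  have h2 : ∀ i q r, b i q = b' i r → b i q = b i r := fun i q r hqr => by
    rcases h i with h | h
    · rwa [h] at hqr ⊢
    · exact h.eq_of_eq_left hqr
  have hc : G.Compat (Sum.elim D D) (Sum.elim (G.localConfig D b) (G.localConfig D b')) := by
    rintro v (s | s) (t | t) hp hi
    · exact hb v s t hp hi
    · exact hb v s t hp fun i hiv => h2 i _ _ (hi i hiv)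
    · exact hb v s t hp fun i hiv => (h2 i _ _ (hi i hiv).symm).symm
    · exact hb v s t hp fun i hiv => h1 i _ _ (hi i hiv)
  obtain ⟨g, hg⟩ := hc.exists_matches f
  exact ⟨g, fun t => hg (.inl t), fun t => hg (.inr t)⟩

/-- The compatible assignments that depend on the records locally are connected. -/
theorem reflTransGen_joined {G : CausalDiagram Ω U} (f : G.Fns) {ι : Type*}
    {D : ι → (v : V) → Ω v} {a e : (i : U) → G.Local i → Fin (G.d i + 1)}
    (ha : G.Compat D (G.localConfig D a)) (he : ∀ i, Function.Injective (e i)) :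
    Relation.ReflTransGen (G.Joined D) (G.localConfig D a) (G.localConfig D e) := by
  suffices H : ∀ s : Finset U, ∃ b, G.Compat D (G.localConfig D b) ∧
      Relation.ReflTransGen (G.Joined D) (G.localConfig D a) (G.localConfig D b) ∧
      ∀ i ∈ s, b i = e i by
    obtain ⟨b, -, hb, hbe⟩ := H Finset.univ
    rwa [show b = e from funext fun i => hbe i (Finset.mem_univ _)] at hb
  intro s
  induction s using Finset.induction_on with
  | empty => exact ⟨a, ha, .refl, by simp⟩
  | insert i s _ ih =>
    obtain ⟨b, hb, hab, hbe⟩ := ih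
    -- Only the labels of `i` move, along a path of relabelings; each intermediate assignment
    -- inherits compatibility from the common family of functions.
    have hstep : G.Compat D (G.localConfig D (Function.update b i (e i))) ∧
        Relation.ReflTransGen (G.Joined D) (G.localConfig D a)
          (G.localConfig D (Function.update b i (e i))) := by
      have hrel := reflTransGen_relabel (G.card_local_lt i) (b i) (e i) (he i)
      clear hbe he
      generalize e i = r₀ at hrel ⊢
      induction hrel with
      | refl => rw [Function.update_eq_self]; exact ⟨hb, hab⟩
      | @tail q r _ hqr ih =>
        obtain ⟨g, hg⟩ := joined_of_relabel f ih.1 (b' := Function.update b i r) fun j => by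
          by_cases hj : j = i
          · subst hj; right; simpa using hqr
          · left; simp [hj]
        exact ⟨hg.2.compat, ih.2.tail ⟨g, hg⟩⟩
    refine ⟨_, hstep.1, hstep.2, fun j hj => ?_⟩
    by_cases hji : j = i
    · subst hji; simp
    · rw [Function.update_of_ne hji]
      exact hbe j ((Finset.mem_insert.1 hj).resolve_left hji)

end CausalDiagram

/-! ### The Dirichlet distribution: normalization, support, conjugacy. -/

section Dirichlet

theorem lintegral_beta_lt_top {a b : ℝ} (ha : 0 < a) (hb : 0 < b) :
    ∫⁻ x in Set.Ioo (0 : ℝ) 1, ENNReal.ofReal (x ^ (a - 1) * (1 - x) ^ (b - 1)) < ⊤ := by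
  have h := lintegral_betaPDF_eq_one ha hb
  rw [lintegral_betaPDF] at h
  have hc : 0 < 1 / beta a b := one_div_pos.2 (beta_pos ha hb)
  simp only [mul_assoc, ENNReal.ofReal_mul hc.le] at h
  rw [lintegral_const_mul _ (by fun_prop)] at h
  rw [lt_top_iff_ne_top]
  intro ht
  rw [ht, ENNReal.mul_top (by simpa using hc)] at h
  simp at h

/-- Substitution `x ↦ s * x`: the Jacobian and the two powers contribute `1 + (a - 1) + (b - 1)` to
the exponent of `s`. -/
theorem lintegral_beta_scaled {a b s : ℝ} (hs : 0 < s) :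
    ∫⁻ x in Set.Ioo (0 : ℝ) s, ENNReal.ofReal (x ^ (a - 1) * (s - x) ^ (b - 1)) =
      ENNReal.ofReal (s ^ (a + b - 1)) *
        ∫⁻ x in Set.Ioo (0 : ℝ) 1, ENNReal.ofReal (x ^ (a - 1) * (1 - x) ^ (b - 1)) := by
  rw [← lintegral_indicator measurableSet_Ioo, ← lintegral_indicator measurableSet_Ioo]
  conv_lhs => rw [← Real.smul_map_volume_mul_left hs.ne', lintegral_smul_measure]
  rw [lintegral_map ((by fun_prop : Measurable fun x : ℝ =>
    ENNReal.ofReal (x ^ (a - 1) * (s - x) ^ (b - 1))).indicator measurableSet_Ioo) (by fun_prop),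
    smul_eq_mul, ← lintegral_const_mul' _ _ ENNReal.ofReal_ne_top,
    ← lintegral_const_mul' _ _ ENNReal.ofReal_ne_top]
  refine lintegral_congr fun x => ?_
  by_cases hx : x ∈ Set.Ioo (0 : ℝ) 1
  · have hx' : s * x ∈ Set.Ioo (0 : ℝ) s :=
      ⟨mul_pos hs hx.1, by nlinarith [hx.2]⟩
    rw [Set.indicator_of_mem hx, Set.indicator_of_mem hx', ← ENNReal.ofReal_mul (abs_nonneg s),
      ← ENNReal.ofReal_mul (Real.rpow_nonneg hs.le _), abs_of_pos hs,
      show s - s * x = s * (1 - x) by ring, Real.mul_rpow hs.le hx.1.le,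
      Real.mul_rpow hs.le (by linarith [hx.2]),
      show a + b - 1 = 1 + (a - 1) + (b - 1) by ring, Real.rpow_add hs, Real.rpow_add hs,
      Real.rpow_one]
    congr 1
    ring
  · have hx' : s * x ∉ Set.Ioo (0 : ℝ) s := fun h =>
      hx ⟨(mul_pos_iff_of_pos_left hs).1 h.1, by
        by_contra hc
        exact absurd h.2 (by nlinarith)⟩
    rw [Set.indicator_of_notMem hx, Set.indicator_of_notMem hx']
    simp

theorem measurableSet_solidSimplex (n : ℕ) (s : ℝ) :
    MeasurableSet {y : Fin n → ℝ | (∀ k, 0 ≤ y k) ∧ ∑ k, y k ≤ s} := by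
  rw [show {y : Fin n → ℝ | (∀ k, 0 ≤ y k) ∧ ∑ k, y k ≤ s} =
    (⋂ k, {y | 0 ≤ y k}) ∩ {y | ∑ k, y k ≤ s} by ext; simp]
  exact (MeasurableSet.iInter fun k => measurableSet_le measurable_const (by fun_prop)).inter
    (measurableSet_le (by fun_prop) measurable_const)

theorem measurableSet_forall_pos (n : ℕ) : MeasurableSet {x : Fin n → ℝ | ∀ k, 0 < x k} := by
  rw [show {x : Fin n → ℝ | ∀ k, 0 < x k} = ⋂ k, {x | 0 < x k} by ext; simp]
  exact MeasurableSet.iInter fun k => measurableSet_lt measurable_const (by fun_prop)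

/-- The Dirichlet integral over a simplex of size `s` is at most a multiple of a power of `s`. -/
theorem exists_lintegral_simplex_le (n : ℕ) (θ : Fin n → ℝ) (hθ : ∀ k, 0 < θ k) (b : ℝ)
    (hb : 0 < b) :
    ∃ C : ℝ≥0∞, C ≠ ⊤ ∧ ∃ r : ℝ, 0 < r ∧ ∀ s, 0 < s →
      ∫⁻ y : Fin n → ℝ, {y : Fin n → ℝ | (∀ k, 0 ≤ y k) ∧ ∑ k, y k ≤ s}.indicator
        (fun y => ENNReal.ofReal ((∏ k, y k ^ (θ k - 1)) * (s - ∑ k, y k) ^ (b - 1))) y ≤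
        C * ENNReal.ofReal (s ^ (r - 1)) := by
  -- Fixing the first coordinate `x` leaves a simplex of size `s - x`, whose integral is bounded by
  -- a multiple of `(s - x) ^ (r - 1)`; the outer integral is then of beta type, and `r` grows by `θ
  -- 0`.
  induction n with
  | zero =>
    refine ⟨1, ENNReal.one_ne_top, b, hb, fun s hs => ?_⟩
    rw [lintegral_unique]
    simp [volume_pi, hs.le]
  | succ n ih =>
    obtain ⟨C, hC, r, hr, h⟩ := ih (fun k => θ k.succ) (fun k => hθ _)
    have hfin := lintegral_beta_lt_top (hθ 0) hr
    refine ⟨C * ∫⁻ x in Set.Ioo (0 : ℝ) 1, ENNReal.ofReal (x ^ (θ 0 - 1) * (1 - x) ^ (r - 1)),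
      ENNReal.mul_ne_top hC hfin.ne, θ 0 + r, add_pos (hθ 0) hr, fun s hs => ?_⟩
    have hmeas : ∀ (m : ℕ) (η : Fin m → ℝ) (t : ℝ), Measurable
        ({y : Fin m → ℝ | (∀ k, 0 ≤ y k) ∧ ∑ k, y k ≤ t}.indicator
        (fun y => ENNReal.ofReal ((∏ k, y k ^ (η k - 1)) * (t - ∑ k, y k) ^ (b - 1)))) := by
      intro m η t
      exact Measurable.indicator (by fun_prop) (measurableSet_solidSimplex m t)
    rw [← (volume_preserving_piFinSuccAbove (fun _ : Fin (n + 1) => ℝ) 0).symm.lintegral_comp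
      (hmeas _ _ _), Measure.volume_eq_prod, lintegral_prod]
    swap
    · exact ((hmeas _ _ _).comp (MeasurableEquiv.measurable _)).aemeasurable
    calc _ ≤ ∫⁻ x in Set.Icc (0 : ℝ) s, ENNReal.ofReal (x ^ (θ 0 - 1)) *
          ∫⁻ y : Fin n → ℝ, {y : Fin n → ℝ | (∀ k, 0 ≤ y k) ∧ ∑ k, y k ≤ s - x}.indicator
            (fun y => ENNReal.ofReal ((∏ k, y k ^ (θ k.succ - 1)) *
              (s - x - ∑ k, y k) ^ (b - 1))) y := by
          rw [← lintegral_indicator measurableSet_Icc]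
          refine lintegral_mono fun x => ?_
          by_cases hx : x ∈ Set.Icc (0 : ℝ) s
          · rw [Set.indicator_of_mem hx, ← lintegral_const_mul' _ _ ENNReal.ofReal_ne_top]
            refine lintegral_mono fun y => ?_
            by_cases hy : y ∈ {y : Fin n → ℝ | (∀ k, 0 ≤ y k) ∧ ∑ k, y k ≤ s - x}
            · rw [Set.indicator_of_mem hy, ← ENNReal.ofReal_mul (Real.rpow_nonneg hx.1 _)]
              refine (Set.indicator_le_self _ _ _).trans (le_of_eq ?_)
              simp [MeasurableEquiv.piFinSuccAbove, Fin.insertNthEquiv, Fin.prod_univ_succ,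
                Fin.sum_univ_succ, mul_assoc, sub_sub]
            · rw [Set.indicator_of_notMem hy, mul_zero, Set.indicator_of_notMem]
              refine fun hc => hy ?_
              simp only [MeasurableEquiv.piFinSuccAbove, Fin.insertNthEquiv, Set.mem_ofPred_eq,
                Fin.forall_fin_succ, Fin.sum_univ_succ] at hc
              simp at hc
              exact ⟨hc.1.2, by linarith [hc.2]⟩
          · rw [Set.indicator_of_notMem hx]
            refine le_of_eq (lintegral_eq_zero_of_ae_eq_zero (.of_forall fun y => ?_))
            refine Set.indicator_of_notMem (fun hc => hx ?_) _
            simp only [MeasurableEquiv.piFinSuccAbove, Fin.insertNthEquiv, Set.mem_ofPred_eq,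
              Fin.forall_fin_succ, Fin.sum_univ_succ] at hc
            simp at hc
            have hsum := Finset.sum_nonneg (s := Finset.univ) fun k _ => hc.1.2 k
            exact ⟨hc.1.1, by linarith [hc.2]⟩
      -- The endpoints are dropped because the induction hypothesis needs a simplex of positive
      -- size.
      _ = ∫⁻ x in Set.Ioo (0 : ℝ) s, ENNReal.ofReal (x ^ (θ 0 - 1)) *
          ∫⁻ y : Fin n → ℝ, {y : Fin n → ℝ | (∀ k, 0 ≤ y k) ∧ ∑ k, y k ≤ s - x}.indicator
            (fun y => ENNReal.ofReal ((∏ k, y k ^ (θ k.succ - 1)) *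
              (s - x - ∑ k, y k) ^ (b - 1))) y := by
          rw [Measure.restrict_congr_set Ioo_ae_eq_Icc]
      _ ≤ ∫⁻ x in Set.Ioo (0 : ℝ) s,
          C * ENNReal.ofReal (x ^ (θ 0 - 1) * (s - x) ^ (r - 1)) := by
          refine setLIntegral_mono (by fun_prop) fun x hx => ?_
          rw [ENNReal.ofReal_mul (Real.rpow_nonneg hx.1.le _), mul_left_comm]
          gcongr
          exact h (s - x) (by linarith [hx.2])
      _ = _ := by
          rw [lintegral_const_mul _ (by fun_prop), lintegral_beta_scaled hs, mul_assoc, mul_comm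
            (ENNReal.ofReal _)]

/-- Lebesgue measure on the simplex, in the first `n` coordinates. -/
noncomputable def simplexMeasure (n : ℕ) : Measure (Fin (n + 1) → ℝ) :=
  ((volume : Measure (Fin n → ℝ)).restrict {y | (∀ k, 0 ≤ y k) ∧ ∑ k, y k ≤ 1}).map
    (fun y => Fin.snoc (α := fun _ => ℝ) y (1 - ∑ k, y k))

/-- The Dirichlet density without its normalizing constant. -/
noncomputable def dirichletWeight {n : ℕ} (θ : Fin (n + 1) → ℝ) (x : Fin (n + 1) → ℝ) : ℝ≥0∞ :=
  ENNReal.ofReal (∏ k, x k ^ (θ k - 1))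

theorem dirichlet_eq {n : ℕ} (θ : Fin (n + 1) → ℝ) :
    dirichlet θ = ((simplexMeasure n).withDensity (dirichletWeight θ) Set.univ)⁻¹ •
      (simplexMeasure n).withDensity (dirichletWeight θ) := rfl

theorem measurable_dirichletWeight {n : ℕ} (θ : Fin (n + 1) → ℝ) :
    Measurable (dirichletWeight θ) := by
  unfold dirichletWeight
  fun_prop

theorem measurable_snoc_simplex (n : ℕ) :
    Measurable fun y : Fin n → ℝ => Fin.snoc (α := fun _ => ℝ) y (1 - ∑ k, y k) := by
  refine measurable_pi_lambda _ fun k => ?_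
  induction k using Fin.lastCases with
  | last => simp only [Fin.snoc_last]; fun_prop
  | cast k => simp only [Fin.snoc_castSucc]; fun_prop

theorem measurableSet_stdSimplex_fin (n : ℕ) : MeasurableSet (stdSimplex ℝ (Fin n)) :=
  (isClosed_stdSimplex ℝ (Fin n)).measurableSet

theorem ae_mem_stdSimplex_simplexMeasure (n : ℕ) :
    ∀ᵐ x ∂simplexMeasure n, x ∈ stdSimplex ℝ (Fin (n + 1)) := by
  refine (ae_map_iff (measurable_snoc_simplex n).aemeasurable
    (measurableSet_stdSimplex_fin _)).2 ?_
  refine ae_restrict_of_forall_mem (measurableSet_solidSimplex n 1) fun y hy => ⟨fun k => ?_, ?_⟩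
  · induction k using Fin.lastCases with
    | last => simpa using hy.2
    | cast k => simpa using hy.1 k
  · simp [Fin.sum_univ_castSucc]

theorem simplexMeasure_forall_pos_ne_zero (n : ℕ) :
    simplexMeasure n {x | ∀ k, 0 < x k} ≠ 0 := by
  rw [simplexMeasure, Measure.map_apply (measurable_snoc_simplex n) (measurableSet_forall_pos _),
    Measure.restrict_apply (measurable_snoc_simplex n (measurableSet_forall_pos _))]
  have hopen : IsOpen {y : Fin n → ℝ | (∀ k, 0 < y k) ∧ ∑ k, y k < 1} := by
    rw [show {y : Fin n → ℝ | (∀ k, 0 < y k) ∧ ∑ k, y k < 1} =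
      (⋂ k, {y | 0 < y k}) ∩ {y | ∑ k, y k < 1} by ext; simp]
    exact (isOpen_iInter_of_finite fun k => isOpen_lt continuous_const (by fun_prop)).inter
      (isOpen_lt (by fun_prop) continuous_const)
  have hne : {y : Fin n → ℝ | (∀ k, 0 < y k) ∧ ∑ k, y k < 1}.Nonempty := by
    refine ⟨fun _ => 1 / (n + 1), fun _ => by positivity, ?_⟩
    rw [Finset.sum_const, Finset.card_univ, Fintype.card_fin, nsmul_eq_mul, mul_one_div,
      div_lt_one (by positivity)]
    linarith
  have hsub : {y : Fin n → ℝ | (∀ k, 0 < y k) ∧ ∑ k, y k < 1} ⊆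
      (fun y => Fin.snoc (α := fun _ => ℝ) y (1 - ∑ k, y k)) ⁻¹' {x | ∀ k, 0 < x k} ∩
        {y | (∀ k, 0 ≤ y k) ∧ ∑ k, y k ≤ 1} := by
    refine fun y hy => ⟨fun k => ?_, fun k => (hy.1 k).le, hy.2.le⟩
    induction k using Fin.lastCases with
    | last => simpa using hy.2
    | cast k => simpa using hy.1 k
  exact ((hopen.measure_pos volume hne).trans_le (measure_mono hsub)).ne'

/-- This is the simplex bound at size `1`, the last parameter being the exponent of the slack
coordinate. -/
theorem dirichletWeight_univ_ne_top {n : ℕ} {θ : Fin (n + 1) → ℝ} (hθ : ∀ k, 0 < θ k) :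
    (simplexMeasure n).withDensity (dirichletWeight θ) Set.univ ≠ ⊤ := by
  obtain ⟨C, hC, r, -, h⟩ := exists_lintegral_simplex_le n (fun k => θ k.castSucc)
    (fun k => hθ _) (θ (Fin.last n)) (hθ _)
  have h1 := h 1 one_pos
  rw [Real.one_rpow, ENNReal.ofReal_one, mul_one,
    lintegral_indicator (measurableSet_solidSimplex n 1)] at h1
  rw [withDensity_apply _ MeasurableSet.univ, Measure.restrict_univ, simplexMeasure,
    lintegral_map (measurable_dirichletWeight θ) (measurable_snoc_simplex n)]
  refine ne_top_of_le_ne_top hC (le_trans (le_of_eq (lintegral_congr fun y => ?_)) h1)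
  simp [dirichletWeight, Fin.prod_univ_castSucc]

theorem withDensity_dirichletWeight_forall_pos_ne_zero {n : ℕ} (θ : Fin (n + 1) → ℝ) :
    (simplexMeasure n).withDensity (dirichletWeight θ) {x | ∀ k, 0 < x k} ≠ 0 := by
  intro h
  rw [withDensity_apply_eq_zero (measurable_dirichletWeight θ)] at h
  refine simplexMeasure_forall_pos_ne_zero n (measure_mono_null
    (t := {x | dirichletWeight θ x ≠ 0} ∩ {x | ∀ k, 0 < x k}) (fun x hx => ⟨?_, hx⟩) h)
  have : 0 < ∏ k, x k ^ (θ k - 1) := Finset.prod_pos fun k _ => Real.rpow_pos_of_pos (hx k) _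
  simpa [dirichletWeight] using this

theorem dirichletWeight_univ_ne_zero {n : ℕ} (θ : Fin (n + 1) → ℝ) :
    (simplexMeasure n).withDensity (dirichletWeight θ) Set.univ ≠ 0 := fun h =>
  withDensity_dirichletWeight_forall_pos_ne_zero θ (measure_mono_null (Set.subset_univ _) h)

theorem isProbabilityMeasure_dirichlet {n : ℕ} {θ : Fin (n + 1) → ℝ} (hθ : ∀ k, 0 < θ k) :
    IsProbabilityMeasure (dirichlet θ) := by
  refine ⟨?_⟩
  rw [dirichlet_eq, Measure.smul_apply, smul_eq_mul]
  exact ENNReal.inv_mul_cancel (dirichletWeight_univ_ne_zero θ) (dirichletWeight_univ_ne_top hθ)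

theorem ae_mem_stdSimplex_dirichlet {n : ℕ} (θ : Fin (n + 1) → ℝ) :
    ∀ᵐ x ∂dirichlet θ, x ∈ stdSimplex ℝ (Fin (n + 1)) := by
  rw [dirichlet_eq]
  exact Measure.ae_smul_measure ((withDensity_absolutelyContinuous _ _).ae_le
    (ae_mem_stdSimplex_simplexMeasure n)) _

theorem dirichlet_forall_pos_ne_zero {n : ℕ} {θ : Fin (n + 1) → ℝ} (hθ : ∀ k, 0 < θ k) :
    dirichlet θ {x | ∀ k, 0 < x k} ≠ 0 := by
  rw [dirichlet_eq, Measure.smul_apply, smul_eq_mul]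
  exact mul_ne_zero (ENNReal.inv_ne_zero.2 (dirichletWeight_univ_ne_top hθ))
    (withDensity_dirichletWeight_forall_pos_ne_zero θ)

/-- The Dirichlet distribution is conjugate to multinomial likelihoods. -/
theorem exists_dirichlet_withDensity {n : ℕ} {θ : Fin (n + 1) → ℝ} (hθ : ∀ k, 0 < θ k)
    (m : Fin (n + 1) → ℕ) :
    ∃ a : ℝ≥0∞, a ≠ ⊤ ∧ (dirichlet θ).withDensity (fun x => ENNReal.ofReal (∏ k, x k ^ m k)) =
      a • dirichlet fun k => θ k + m k := by
  have hpos : ∀ k, 0 < θ k + m k := fun k => add_pos_of_pos_of_nonneg (hθ k) (Nat.cast_nonneg _)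
  set Z := (simplexMeasure n).withDensity (dirichletWeight fun k => θ k + m k) Set.univ with hZ
  refine ⟨((simplexMeasure n).withDensity (dirichletWeight θ) Set.univ)⁻¹ * Z,
    ENNReal.mul_ne_top (ENNReal.inv_ne_top.2 (dirichletWeight_univ_ne_zero θ))
      (dirichletWeight_univ_ne_top hpos), ?_⟩
  have hZ0 : Z ≠ 0 := dirichletWeight_univ_ne_zero _
  have hZt : Z ≠ ⊤ := dirichletWeight_univ_ne_top hpos
  rw [dirichlet_eq, dirichlet_eq, ← hZ, smul_smul, mul_assoc, ENNReal.mul_inv_cancel hZ0 hZt,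
    mul_one, withDensity_smul_measure, ← withDensity_mul _ (measurable_dirichletWeight θ)
    (by fun_prop)]
  congr 1
  refine withDensity_congr_ae ?_
  filter_upwards [ae_mem_stdSimplex_simplexMeasure n] with x hx
  rw [Pi.mul_apply, dirichletWeight, dirichletWeight, ← ENNReal.ofReal_mul
    (Finset.prod_nonneg fun k _ => Real.rpow_nonneg (hx.1 k) _), ← Finset.prod_mul_distrib]
  congr 1
  refine Finset.prod_congr rfl fun k _ => ?_
  -- At `x k = 0` with `m k ≥ 1` both sides vanish, because `θ k + m k - 1 > 0`; with `m k = 0` the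
  -- factors agree.
  rcases (hx.1 k).eq_or_lt with h0 | h0
  · rcases Nat.eq_zero_or_pos (m k) with hm | hm
    · simp [hm]
    · rw [← h0, zero_pow hm.ne', mul_zero, Real.zero_rpow]
      have : (1 : ℝ) ≤ m k := by exact_mod_cast hm
      linarith [hθ k]
  · rw [← Real.rpow_natCast, ← Real.rpow_add h0]
    congr 1
    ring

end Dirichlet

/-! ### Densities on finite products. -/

section Pi

variable {ι : Type*} [Fintype ι] {X : ι → Type*} [∀ i, MeasurableSpace (X i)]

theorem lintegral_pi_prod (μ : (i : ι) → Measure (X i)) [∀ i, IsProbabilityMeasure (μ i)]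
    (g : (i : ι) → X i → ℝ≥0∞) (hg : ∀ i, Measurable (g i)) :
    ∫⁻ x, ∏ i, g i (x i) ∂Measure.pi μ = ∏ i, ∫⁻ y, g i y ∂μ i := by
  have hind := iIndepFun_pi (μ := μ) (X := g) fun i => (hg i).aemeasurable
  refine (lintegral_prod_eq_prod_lintegral_of_indepFun Finset.univ
    (fun i (x : (i : ι) → X i) => g i (x i)) hind
    fun i => (hg i).comp (measurable_pi_apply i)).trans ?_
  exact Finset.prod_congr rfl fun i _ => (measurePreserving_eval μ i).lintegral_comp (hg i)

theorem pi_withDensity_eq_smul (μ ν : (i : ι) → Measure (X i)) [∀ i, IsProbabilityMeasure (μ i)]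
    [∀ i, IsProbabilityMeasure (ν i)] (g : (i : ι) → X i → ℝ≥0∞) (hg : ∀ i, Measurable (g i))
    (a : ι → ℝ≥0∞) (ha : ∀ i, a i ≠ ⊤) (h : ∀ i, (μ i).withDensity (g i) = a i • ν i) :
    (Measure.pi μ).withDensity (fun x => ∏ i, g i (x i)) = (∏ i, a i) • Measure.pi ν := by
  have : ∀ i, IsFiniteMeasure (a i • ν i) := fun i => Measure.smul_finite _ (ha i)
  rw [← Measure.pi_eq (μ := fun i => a i • ν i) (μ' := (∏ i, a i) • Measure.pi ν)
    fun s _ => by simp [Measure.pi_pi, Finset.prod_mul_distrib]]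
  refine (Measure.pi_eq fun s hs => ?_).symm
  rw [withDensity_apply _ (MeasurableSet.univ_pi hs),
    ← lintegral_indicator (MeasurableSet.univ_pi hs)]
  have hind : ∀ x : (i : ι) → X i, (Set.univ.pi s).indicator (fun x => ∏ i, g i (x i)) x =
      ∏ i, (s i).indicator (g i) (x i) := by
    intro x
    by_cases hx : x ∈ Set.univ.pi s
    · rw [Set.indicator_of_mem hx]
      exact Finset.prod_congr rfl fun i _ => (Set.indicator_of_mem (hx i trivial) _).symm
    · rw [Set.indicator_of_notMem hx]
      obtain ⟨i, hi⟩ : ∃ i, x i ∉ s i := by simpa using hx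
      exact (Finset.prod_eq_zero (Finset.mem_univ i) (Set.indicator_of_notMem hi _)).symm
  rw [lintegral_congr hind, lintegral_pi_prod _ _ fun i => (hg i).indicator (hs i)]
  refine Finset.prod_congr rfl fun i _ => ?_
  rw [lintegral_indicator (hs i), ← withDensity_apply _ (hs i), h i]

theorem MeasureTheory.Measure.bind_fintype {α β : Type*} [MeasurableSpace α] [MeasurableSpace β]
    [Fintype α] [DiscreteMeasurableSpace α] (ν : Measure α) (κ : α → Measure β) :
    ν.bind κ = ∑ a, ν {a} • κ a := by
  ext s hs
  rw [Measure.bind_apply hs (Measurable.of_discrete).aemeasurable, lintegral_fintype]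
  simp [mul_comm]

end Pi

/-! ### Model probabilities and conjugacy of the prior. -/

namespace CausalDiagram

variable {V U : Type*} [Fintype V] [DecidableEq V] [Fintype U] [DecidableEq U]
variable {Ω : V → Type*} [∀ v, Fintype (Ω v)] [∀ v, DecidableEq (Ω v)]

set_option linter.unusedSectionVars false

/-- The parameters in which every `P(U i)` is a probability vector. -/
def probParams (G : CausalDiagram Ω U) : Set G.Params :=
  {θ | ∀ i, θ.1 i ∈ stdSimplex ℝ (Fin (G.d i + 1))}

theorem exoProb_nonneg {G : CausalDiagram Ω U} {θ : G.Params} (hθ : θ ∈ G.probParams)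
    (u : G.ExVal) : 0 ≤ G.exoProb θ u :=
  Finset.prod_nonneg fun i _ => (hθ i).1 _

theorem sum_exoProb {G : CausalDiagram Ω U} {θ : G.Params} (hθ : θ ∈ G.probParams) :
    ∑ u, G.exoProb θ u = 1 := by
  have h := Finset.prod_univ_sum (fun i => (Finset.univ : Finset (Fin (G.d i + 1))))
    fun i k => θ.1 i k
  rw [Fintype.piFinset_univ] at h
  simp only [exoProb]
  rw [← h]
  exact Finset.prod_eq_one fun i _ => (hθ i).2

theorem obsProb_nonneg {G : CausalDiagram Ω U} {θ : G.Params} (hθ : ∀ u, 0 ≤ G.exoProb θ u)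
    (x : (v : V) → Ω v) : 0 ≤ G.obsProb θ x := by
  refine Finset.sum_nonneg fun u _ => ?_
  split_ifs
  exacts [hθ u, le_rfl]

theorem obsProb_le_one {G : CausalDiagram Ω U} {θ : G.Params} (hθ : θ ∈ G.probParams)
    (x : (v : V) → Ω v) : G.obsProb θ x ≤ 1 := by
  rw [← sum_exoProb hθ]
  refine Finset.sum_le_sum fun u _ => ?_
  split_ifs
  exacts [le_rfl, exoProb_nonneg hθ u]

theorem obsProb_eq (G : CausalDiagram Ω U) (θ : G.Params) (x : (v : V) → Ω v) :
    G.obsProb θ x = ∑ u, if G.obs θ.2 u = x then G.exoProb θ u else 0 := by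
  rw [obsProb, prob]
  exact Finset.sum_congr rfl fun u _ => by congr

theorem exoProb_le_obsProb {G : CausalDiagram Ω U} {θ : G.Params} (hθ : ∀ u, 0 ≤ G.exoProb θ u)
    {x : (v : V) → Ω v} {u : G.ExVal} (hu : G.obs θ.2 u = x) :
    G.exoProb θ u ≤ G.obsProb θ x := by
  rw [obsProb_eq]
  refine le_trans (le_of_eq (if_pos hu).symm) (Finset.single_le_sum
    (f := fun u => if G.obs θ.2 u = x then G.exoProb θ u else 0) (fun u _ => ?_)
    (Finset.mem_univ u))
  split_ifs
  exacts [hθ u, le_rfl]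

theorem condExo_nonneg {G : CausalDiagram Ω U} {θ : G.Params} (hθ : ∀ u, 0 ≤ G.exoProb θ u)
    (x : (v : V) → Ω v) (u : G.ExVal) : 0 ≤ G.condExo θ x u := by
  rw [condExo]
  split_ifs
  · positivity
  · exact div_nonneg (hθ u) (obsProb_nonneg hθ x)
  · simp

theorem sum_condExo (G : CausalDiagram Ω U) (θ : G.Params) (x : (v : V) → Ω v) :
    ∑ u, G.condExo θ x u = 1 := by
  by_cases h : G.obsProb θ x = 0
  · have : (Fintype.card G.ExVal : ℝ) ≠ 0 := by
      have : Nonempty G.ExVal := ⟨fun _ => 0⟩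
      exact_mod_cast Fintype.card_ne_zero
    simp only [condExo, if_pos h, Finset.sum_const, Finset.card_univ, nsmul_eq_mul]
    exact mul_inv_cancel₀ this
  · simp only [condExo, if_neg h, ← Finset.sum_div]
    rw [← obsProb_eq, div_self h]

/-- The joint probability of the exogenous values `c` and the data. -/
noncomputable def jointProb (G : CausalDiagram Ω U) {T : ℕ} (D : Fin T → (v : V) → Ω v)
    (c : G.Config T) (θ : G.Params) : ℝ :=
  ∏ t, if G.obs θ.2 (c t) = D t then G.exoProb θ (c t) else 0

theorem jointProb_nonneg {G : CausalDiagram Ω U} {θ : G.Params} (hθ : ∀ u, 0 ≤ G.exoProb θ u)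
    {T : ℕ} (D : Fin T → (v : V) → Ω v) (c : G.Config T) : 0 ≤ G.jointProb D c θ := by
  refine Finset.prod_nonneg fun t _ => ?_
  split_ifs
  exacts [hθ _, le_rfl]

theorem sum_jointProb (G : CausalDiagram Ω U) {T : ℕ} (D : Fin T → (v : V) → Ω v)
    (θ : G.Params) : ∑ c, G.jointProb D c θ = ∏ t, G.obsProb θ (D t) := by
  simp only [obsProb_eq, Finset.prod_univ_sum, Fintype.piFinset_univ]
  rfl

/-- The uniform fallback in `condExo` is harmless: it occurs only if the record has probability
zero, and then every unit producing the record has probability zero too. -/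
theorem prod_obsProb_mul_prod_condExo {G : CausalDiagram Ω U} {θ : G.Params}
    (hθ : ∀ u, 0 ≤ G.exoProb θ u) {T : ℕ} (D : Fin T → (v : V) → Ω v) (c : G.Config T) :
    (∏ t, G.obsProb θ (D t)) * ∏ t, G.condExo θ (D t) (c t) = G.jointProb D c θ := by
  rw [jointProb, ← Finset.prod_mul_distrib]
  refine Finset.prod_congr rfl fun t _ => ?_
  rw [condExo]
  by_cases h : G.obsProb θ (D t) = 0
  · rw [if_pos h, h, zero_mul]
    split_ifs with ht
    · exact le_antisymm (hθ _) (h ▸ exoProb_le_obsProb hθ ht)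
    · rfl
  · rw [if_neg h, mul_div_cancel₀ _ h]

theorem prod_exoProb_eq (G : CausalDiagram Ω U) {T : ℕ} (c : G.Config T) (θ : G.Params) :
    ∏ t, G.exoProb θ (c t) =
      ∏ i, ∏ k, θ.1 i k ^ (Finset.univ.filter fun t => c t i = k).card := by
  simp only [exoProb]
  rw [Finset.prod_comm]
  refine Finset.prod_congr rfl fun i _ => ?_
  rw [← Finset.prod_fiberwise' Finset.univ (fun t => c t i) (θ.1 i)]
  simp only [Finset.prod_const]

open Classical in
theorem jointProb_eq (G : CausalDiagram Ω U) {T : ℕ} (D : Fin T → (v : V) → Ω v)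
    (c : G.Config T) (θ : G.Params) : G.jointProb D c θ =
      (if G.Matches D c θ.2 then 1 else 0) *
        ∏ i, ∏ k, θ.1 i k ^ (Finset.univ.filter fun t => c t i = k).card := by
  rw [← prod_exoProb_eq, jointProb, Finset.prod_ite_zero]
  by_cases h : G.Matches D c θ.2
  · rw [if_pos h, if_pos fun t _ => h t, one_mul]
  · rw [if_neg h, if_neg fun h' => h fun t => h' t (Finset.mem_univ t), zero_mul]

variable [∀ v, MeasurableSpace (Ω v)] [∀ v, DiscreteMeasurableSpace (Ω v)]

theorem measurableSet_probParams (G : CausalDiagram Ω U) : MeasurableSet G.probParams := by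
  rw [show G.probParams = ⋂ i, (fun θ : G.Params => θ.1 i) ⁻¹' stdSimplex ℝ (Fin (G.d i + 1)) by
    ext; simp [probParams]]
  exact MeasurableSet.iInter fun i =>
    ((measurable_pi_apply i).comp measurable_fst) (measurableSet_stdSimplex_fin _)

instance isProbabilityMeasure_fnLaw (G : CausalDiagram Ω U) (ρ : G.Prior) :
    IsProbabilityMeasure (G.fnLaw ρ) := by
  unfold fnLaw
  infer_instance

theorem fnLaw_box (G : CausalDiagram Ω U) (ρ : G.Prior)
    (S : (v : V) → ((p : G.pa v) → Ω p) → ((i : G.ex v) → Fin (G.d i + 1)) → Set (Ω v)) :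
    G.fnLaw ρ {f | ∀ v p e, f v p e ∈ S v p e} =
      ∏ v, ∏ p, ∏ e, (ρ.φ v p e).toMeasure (S v p e) := by
  rw [show {f : G.Fns | ∀ v p e, f v p e ∈ S v p e} =
    Set.univ.pi fun v => Set.univ.pi fun p => Set.univ.pi fun e => S v p e by ext; simp]
  rw [fnLaw, Measure.pi_pi]
  simp only [Measure.pi_pi]

theorem fnLaw_singleton (G : CausalDiagram Ω U) (ρ : G.Prior) (f : G.Fns) :
    G.fnLaw ρ {f} = ∏ v, ∏ p, ∏ e, (ρ.φ v p e).toMeasure {f v p e} := by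
  rw [← fnLaw_box]
  congr 1
  ext g
  simp [funext_iff]

theorem fnLaw_singleton_ne_zero (G : CausalDiagram Ω U) (ρ : G.Prior) (f : G.Fns) :
    G.fnLaw ρ {f} ≠ 0 := by
  rw [fnLaw_singleton]
  refine Finset.prod_ne_zero_iff.2 fun v _ => Finset.prod_ne_zero_iff.2 fun p _ =>
    Finset.prod_ne_zero_iff.2 fun e _ => ?_
  rw [PMF.toMeasure_apply_singleton _ _ (measurableSet_singleton _)]
  exact ρ.φ_pos v p e _

theorem nonempty_fns (G : CausalDiagram Ω U) (ρ : G.Prior) : Nonempty G.Fns :=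
  nonempty_of_isProbabilityMeasure (G.fnLaw ρ)

open Classical in
/-- The law of random functions, restricted to those that match the data, is proportional to the law
of random functions updated to match the data. -/
theorem exists_fnLaw_withDensity (G : CausalDiagram Ω U) (ρ : G.Prior) {T : ℕ}
    (D : Fin T → (v : V) → Ω v) (c : G.Config T) :
    ∃ a : ℝ≥0∞, (G.fnLaw ρ).withDensity (fun f => if G.Matches D c f then 1 else 0) =
      a • (G.fnLaw ρ).map (G.matchData D c) := by
  obtain ⟨f₁⟩ := G.nonempty_fns ρ
  by_cases hc : G.Compat D c
  swap
  · refine ⟨0, ?_⟩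
    rw [show (fun f => if G.Matches D c f then (1 : ℝ≥0∞) else 0) = 0 from
      funext fun f => if_neg fun h => hc h.compat, withDensity_zero, zero_smul]
  have hf₀ := hc.matches_matchData f₁
  set f₀ := G.matchData D c f₁
  -- The constant is the prior probability of the forced values at the hit arguments; there all
  -- matching families agree, so `f₀` serves as reference.
  refine ⟨∏ v, ∏ p, ∏ e, if ∃ t, G.Hits (D t) (c t) v p e then
    (ρ.φ v p e).toMeasure {f₀ v p e} else 1, ?_⟩
  refine Measure.ext_of_singleton fun g => ?_
  rw [withDensity_apply _ (measurableSet_singleton g), lintegral_singleton, Measure.smul_apply,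
    Measure.map_apply Measurable.of_discrete (measurableSet_singleton g), smul_eq_mul]
  by_cases hg : G.Matches D c g
  · rw [if_pos hg, one_mul]
    have hpre : G.matchData D c ⁻¹' {g} = {f | ∀ v p e, f v p e ∈
        if ∃ t, G.Hits (D t) (c t) v p e then Set.univ else {g v p e}} := by
      ext f
      rw [Set.mem_preimage, Set.mem_singleton_iff, Set.mem_ofPred_eq]
      constructor
      · rintro rfl v p e
        rcases G.matchData_apply D c f v p e with ⟨t, ht, -⟩ | ⟨hn, h⟩
        · rw [if_pos ⟨t, ht⟩]; trivial
        · rw [if_neg (fun ⟨t, ht⟩ => hn t ht), h]; rfl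
      · intro h
        funext v p e
        rcases G.matchData_apply D c f v p e with ⟨t, ht, htv⟩ | ⟨hn, hv⟩
        · rw [htv, hg.eq_of_hits ht]
        · have := h v p e
          rw [if_neg (fun ⟨t, ht⟩ => hn t ht)] at this
          rw [hv]; exact this
    rw [hpre, fnLaw_box, fnLaw_singleton, ← Finset.prod_mul_distrib]
    refine Finset.prod_congr rfl fun v _ => ?_
    rw [← Finset.prod_mul_distrib]
    refine Finset.prod_congr rfl fun p _ => ?_
    rw [← Finset.prod_mul_distrib]
    refine Finset.prod_congr rfl fun e _ => ?_
    split_ifs with h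
    · obtain ⟨t, ht⟩ := h
      rw [measure_univ, mul_one, hf₀.eq_of_hits ht, hg.eq_of_hits ht]
    · rw [one_mul]
  · have hpre : G.matchData D c ⁻¹' {g} = ∅ := by
      ext f
      simp only [Set.mem_preimage, Set.mem_singleton_iff, Set.mem_empty_iff_false, iff_false]
      rintro rfl
      exact hg (hc.matches_matchData f)
    rw [if_neg hg, hpre, measure_empty, mul_zero, zero_mul]

theorem counts_pos (G : CausalDiagram Ω U) (ρ : G.Prior) {T : ℕ} (c : G.Config T) (i : U)
    (k : Fin (G.d i + 1)) : 0 < G.counts ρ c i k :=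
  add_pos_of_pos_of_nonneg (ρ.α_pos i) (Nat.cast_nonneg _)

instance isProbabilityMeasure_dirichlet_counts (G : CausalDiagram Ω U) (ρ : G.Prior) {T : ℕ}
    (c : G.Config T) (i : U) : IsProbabilityMeasure (dirichlet (G.counts ρ c i)) :=
  isProbabilityMeasure_dirichlet (G.counts_pos ρ c i)

instance isProbabilityMeasure_dirichlet_prior (G : CausalDiagram Ω U) (ρ : G.Prior) (i : U) :
    IsProbabilityMeasure (dirichlet fun _ : Fin (G.d i + 1) => ρ.α i) :=
  isProbabilityMeasure_dirichlet fun _ => ρ.α_pos i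

instance isProbabilityMeasure_map_matchData (G : CausalDiagram Ω U) (ρ : G.Prior) {T : ℕ}
    (D : Fin T → (v : V) → Ω v) (c : G.Config T) :
    IsProbabilityMeasure ((G.fnLaw ρ).map (G.matchData D c)) :=
  Measure.isProbabilityMeasure_map Measurable.of_discrete.aemeasurable

instance isProbabilityMeasure_priorLaw (G : CausalDiagram Ω U) (ρ : G.Prior) :
    IsProbabilityMeasure (G.priorLaw ρ) := by
  unfold priorLaw
  infer_instance

theorem drawParams_apply (G : CausalDiagram Ω U) (ρ : G.Prior) {T : ℕ}
    (D : Fin T → (v : V) → Ω v) (c : G.Config T) : G.drawParams ρ D c =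
      (Measure.pi fun i => dirichlet (G.counts ρ c i)).prod
        ((G.fnLaw ρ).map (G.matchData D c)) := rfl

instance isMarkovKernel_drawParams (G : CausalDiagram Ω U) (ρ : G.Prior) {T : ℕ}
    (D : Fin T → (v : V) → Ω v) : IsMarkovKernel (G.drawParams ρ D) :=
  ⟨fun c => by rw [drawParams_apply]; infer_instance⟩

theorem ae_pi_dirichlet (G : CausalDiagram Ω U) (θ : (i : U) → Fin (G.d i + 1) → ℝ)
    [∀ i, IsProbabilityMeasure (dirichlet (θ i))] :
    ∀ᵐ q ∂Measure.pi fun i => dirichlet (θ i), ∀ i, q i ∈ stdSimplex ℝ (Fin (G.d i + 1)) :=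
  ae_all_iff.2 fun i => (Measure.tendsto_eval_ae_ae (μ := fun i => dirichlet (θ i))).eventually
    (ae_mem_stdSimplex_dirichlet (θ i))

theorem ae_mem_probParams_prod (G : CausalDiagram Ω U) (θ : (i : U) → Fin (G.d i + 1) → ℝ)
    [∀ i, IsProbabilityMeasure (dirichlet (θ i))] (ν : Measure G.Fns) [SFinite ν] :
    ∀ᵐ x ∂(Measure.pi fun i => dirichlet (θ i)).prod ν, x ∈ G.probParams :=
  Measure.quasiMeasurePreserving_fst.ae (G.ae_pi_dirichlet θ)

theorem ae_priorLaw (G : CausalDiagram Ω U) (ρ : G.Prior) :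
    ∀ᵐ θ ∂G.priorLaw ρ, θ ∈ G.probParams :=
  G.ae_mem_probParams_prod _ _

theorem ae_drawParams (G : CausalDiagram Ω U) (ρ : G.Prior) {T : ℕ}
    (D : Fin T → (v : V) → Ω v) (c : G.Config T) :
    ∀ᵐ θ ∂G.drawParams ρ D c, θ ∈ G.probParams := by
  rw [drawParams_apply]
  exact G.ae_mem_probParams_prod _ _

theorem measurable_jointProb (G : CausalDiagram Ω U) {T : ℕ} (D : Fin T → (v : V) → Ω v)
    (c : G.Config T) : Measurable (G.jointProb D c) := by
  refine measurable_from_prod_countable_left fun f => ?_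
  simp only [jointProb, exoProb]
  refine Finset.measurable_prod _ fun t _ => ?_
  split_ifs <;> fun_prop

/-- The prior, weighted by the joint probability of the data and the exogenous values `c`, is
proportional to the law of the parameters that are drawn given `c`. -/
theorem exists_priorLaw_withDensity (G : CausalDiagram Ω U) (ρ : G.Prior) {T : ℕ}
    (D : Fin T → (v : V) → Ω v) (c : G.Config T) :
    ∃ a : ℝ≥0∞, (G.priorLaw ρ).withDensity (fun θ => ENNReal.ofReal (G.jointProb D c θ)) =
      a • G.drawParams ρ D c := by
  classical
  obtain ⟨a, ha⟩ := G.exists_fnLaw_withDensity ρ D c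
  choose b hbt hb using fun i => exists_dirichlet_withDensity (fun _ => ρ.α_pos i)
    fun k : Fin (G.d i + 1) => (Finset.univ.filter fun t => c t i = k).card
  have hpi := pi_withDensity_eq_smul (fun i => dirichlet fun _ : Fin (G.d i + 1) => ρ.α i)
    (fun i => dirichlet (G.counts ρ c i)) _ (fun i => by fun_prop) b hbt hb
  refine ⟨(∏ i, b i) * a, ?_⟩
  rw [drawParams_apply, mul_smul, ← Measure.prod_smul_right, ← ha, ← Measure.prod_smul_left,
    ← hpi, prod_withDensity (by fun_prop) Measurable.of_discrete, priorLaw]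
  refine withDensity_congr_ae ?_
  filter_upwards [G.ae_priorLaw ρ] with θ hθ
  rw [jointProb_eq, mul_comm, ENNReal.ofReal_mul (Finset.prod_nonneg fun i _ =>
    Finset.prod_nonneg fun k _ => pow_nonneg ((hθ i).1 k) _),
    ENNReal.ofReal_prod_of_nonneg fun i _ => Finset.prod_nonneg fun k _ =>
      pow_nonneg ((hθ i).1 k) _]
  congr 1
  split_ifs <;> simp

/-! Strictly positive parameters. -/

/-- A nonnegative function that is positive on this set has nonzero integral; both the evidence and
the transition probabilities are bounded away from zero in this way. -/
theorem prod_dirichlet_pos_ne_zero (G : CausalDiagram Ω U) (θ : (i : U) → Fin (G.d i + 1) → ℝ)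
    [∀ i, IsProbabilityMeasure (dirichlet (θ i))] (hθ : ∀ i k, 0 < θ i k) (ν : Measure G.Fns)
    [SFinite ν] (f : G.Fns) (hf : ν {f} ≠ 0) :
    ((Measure.pi fun i => dirichlet (θ i)).prod ν) {x | (∀ i k, 0 < x.1 i k) ∧ x.2 = f} ≠ 0 := by
  rw [show {x : G.Params | (∀ i k, 0 < x.1 i k) ∧ x.2 = f} =
    (Set.univ.pi fun i => {y | ∀ k, 0 < y k}) ×ˢ {f} by ext; simp,
    Measure.prod_prod, Measure.pi_pi]
  exact mul_ne_zero (Finset.prod_ne_zero_iff.2 fun i _ => dirichlet_forall_pos_ne_zero (hθ i)) hf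

theorem exoProb_pos {G : CausalDiagram Ω U} {θ : G.Params} (hθ : ∀ i k, 0 < θ.1 i k)
    (u : G.ExVal) : 0 < G.exoProb θ u :=
  Finset.prod_pos fun i _ => hθ i _

/-! The evidence and the posterior. -/

theorem measurable_obsProb (G : CausalDiagram Ω U) (x : (v : V) → Ω v) :
    Measurable fun θ : G.Params => G.obsProb θ x :=
  G.measurable_prob fun f u => G.obs f u = x

theorem measurable_likelihood (G : CausalDiagram Ω U) {T : ℕ} (D : Fin T → (v : V) → Ω v) :
    Measurable (G.likelihood D) :=
  (Finset.measurable_prod _ fun t _ => G.measurable_obsProb (D t)).ennreal_ofReal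

theorem evidence_le_one (G : CausalDiagram Ω U) (ρ : G.Prior) {T : ℕ}
    (D : Fin T → (v : V) → Ω v) : G.evidence ρ D ≤ 1 := by
  calc G.evidence ρ D ≤ ∫⁻ _, 1 ∂G.priorLaw ρ := by
        refine lintegral_mono_ae ?_
        filter_upwards [G.ae_priorLaw ρ] with θ hθ
        rw [likelihood, ENNReal.ofReal_le_one]
        exact Finset.prod_le_one (fun t _ => obsProb_nonneg (exoProb_nonneg hθ) _)
          fun t _ => obsProb_le_one hθ _
    _ = 1 := by rw [lintegral_one, measure_univ]

/-- An injective assignment of exogenous values to local records. -/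
theorem exists_injective_local (G : CausalDiagram Ω U) :
    ∃ e : (i : U) → G.Local i → Fin (G.d i + 1), ∀ i, Function.Injective (e i) := by
  exact ⟨fun i => (Function.Embedding.nonempty_of_card_le (G.card_local_lt i).le).some,
    fun i => Function.Embedding.injective _⟩

/-- Injective labels are compatible with the data, so some `f` matches; with strictly positive `q`
it gives every record positive probability. -/
theorem evidence_ne_zero (G : CausalDiagram Ω U) (ρ : G.Prior) {T : ℕ}
    {D : Fin T → (v : V) → Ω v} (hD : G.Possible D) : G.evidence ρ D ≠ 0 := by
  obtain ⟨e, he⟩ := G.exists_injective_local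
  obtain ⟨f₀⟩ := G.nonempty_fns ρ
  obtain ⟨f, hf⟩ := (compat_localConfig_of_injective hD he).exists_matches f₀
  intro h
  rw [evidence, lintegral_eq_zero_iff (G.measurable_likelihood D)] at h
  refine G.prod_dirichlet_pos_ne_zero (fun i _ => ρ.α i) (fun i _ => ρ.α_pos i) _ f
    (G.fnLaw_singleton_ne_zero ρ f) (measure_mono_null (fun θ hθ => ?_) h)
  obtain ⟨hpos, rfl⟩ := hθ
  have : 0 < ∏ t, G.obsProb θ (D t) := Finset.prod_pos fun t _ =>
    (exoProb_pos hpos _).trans_le (exoProb_le_obsProb (fun u => (exoProb_pos hpos u).le) (hf t))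
  simpa [likelihood] using this

theorem isProbabilityMeasure_posterior (G : CausalDiagram Ω U) (ρ : G.Prior) {T : ℕ}
    {D : Fin T → (v : V) → Ω v} (hD : G.Possible D) :
    IsProbabilityMeasure (G.posterior ρ D) := by
  refine ⟨?_⟩
  rw [posterior, Measure.smul_apply, withDensity_apply _ MeasurableSet.univ, Measure.restrict_univ,
    smul_eq_mul]
  exact ENNReal.inv_mul_cancel (G.evidence_ne_zero ρ hD)
    (ne_top_of_le_ne_top ENNReal.one_ne_top (G.evidence_le_one ρ D))

theorem ae_posterior (G : CausalDiagram Ω U) (ρ : G.Prior) {T : ℕ} (D : Fin T → (v : V) → Ω v) :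
    ∀ᵐ θ ∂G.posterior ρ D, θ ∈ G.probParams :=
  Measure.ae_smul_measure ((withDensity_absolutelyContinuous _ _).ae_le (G.ae_priorLaw ρ)) _

theorem measurable_ctfValue (G : CausalDiagram Ω U) (μ : CtfMeasure Ω) :
    Measurable (G.ctfValue μ) := by
  unfold ctfValue
  induction μ with
  | nil => simp
  | cons s l ih =>
    simp only [List.map_cons, List.sum_cons]
    exact (((G.measurable_prob fun f u => G.Holds f u s.2.1 ∧ G.Holds f u s.2.2).div
      (G.measurable_prob fun f u => G.Holds f u s.2.2)).const_mul _).add ih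

/-! The kernels of the sampler. -/

theorem drawExo_apply (G : CausalDiagram Ω U) {T : ℕ} (D : Fin T → (v : V) → Ω v)
    (θ : G.Params) : G.drawExo D θ =
      ∑ c, ENNReal.ofReal (∏ t, G.condExo θ (D t) (c t)) • Measure.dirac c := rfl

theorem drawExo_singleton (G : CausalDiagram Ω U) {T : ℕ} (D : Fin T → (v : V) → Ω v)
    (θ : G.Params) (c : G.Config T) :
    G.drawExo D θ {c} = ENNReal.ofReal (∏ t, G.condExo θ (D t) (c t)) := by
  rw [drawExo_apply, Measure.coe_finsetSum, Finset.sum_apply, Finset.sum_eq_single c]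
  · simp
  · intro c' _ hc'
    simp [hc']
  · simp

theorem isProbabilityMeasure_drawExo {G : CausalDiagram Ω U} {T : ℕ}
    (D : Fin T → (v : V) → Ω v) {θ : G.Params} (hθ : θ ∈ G.probParams) :
    IsProbabilityMeasure (G.drawExo D θ) := by
  refine ⟨?_⟩
  have h0 := condExo_nonneg (exoProb_nonneg hθ)
  rw [drawExo_apply, Measure.coe_finsetSum, Finset.sum_apply]
  simp only [Measure.smul_apply, measure_univ, smul_eq_mul, mul_one]
  rw [← ENNReal.ofReal_sum_of_nonneg fun c _ => Finset.prod_nonneg fun t _ => h0 _ _]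
  have h := Finset.prod_univ_sum (fun _ : Fin T => (Finset.univ : Finset G.ExVal))
    fun t u => G.condExo θ (D t) u
  rw [Fintype.piFinset_univ] at h
  rw [← h, Finset.prod_eq_one fun t _ => G.sum_condExo θ (D t), ENNReal.ofReal_one]

/-- Outside `probParams` the truncated weights need not sum to one, so the kernel need not be
Markov. S-finiteness is what the kernel products for the outputs require. -/
instance isSFiniteKernel_drawExo (G : CausalDiagram Ω U) {T : ℕ} (D : Fin T → (v : V) → Ω v) :
    IsSFiniteKernel (G.drawExo D) := by
  have h : G.drawExo D = ∑ c, Kernel.withDensity (Kernel.const G.Params (Measure.dirac c))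
      fun θ _ => ((∏ t, G.condExo θ (D t) (c t)).toNNReal : ℝ≥0∞) := by
    ext θ : 1
    rw [FunLike.coe_sum, Finset.sum_apply, drawExo_apply]
    refine Finset.sum_congr rfl fun c _ => ?_
    rw [Kernel.withDensity_apply, Kernel.const_apply, withDensity_const]
    · rfl
    · exact ((Finset.measurable_prod _ fun t _ =>
        G.measurable_condExo (D t) (c t)).ennreal_ofReal).comp measurable_fst
  rw [h]
  exact Kernel.IsSFiniteKernel.finsetSum _ fun c _ => inferInstance

instance isSFiniteKernel_round (G : CausalDiagram Ω U) (ρ : G.Prior) {T : ℕ}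
    (D : Fin T → (v : V) → Ω v) : IsSFiniteKernel (G.round ρ D) := by
  unfold round
  infer_instance

theorem isProbabilityMeasure_bind_of_ae {α β : Type*} [MeasurableSpace α] [MeasurableSpace β]
    {ν : Measure α} [IsProbabilityMeasure ν] {κ : α → Measure β} (hκ : AEMeasurable κ ν)
    (h : ∀ᵐ a ∂ν, IsProbabilityMeasure (κ a)) : IsProbabilityMeasure (ν.bind κ) := by
  refine ⟨?_⟩
  rw [Measure.bind_apply MeasurableSet.univ hκ, lintegral_congr_ae (g := fun _ => 1)
    (h.mono fun a ha => ha.measure_univ)]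
  simp

theorem ae_bind_drawParams (G : CausalDiagram Ω U) (ρ : G.Prior) {T : ℕ}
    (D : Fin T → (v : V) → Ω v) (ν : Measure (G.Config T)) :
    ∀ᵐ θ ∂ν.bind (G.drawParams ρ D), θ ∈ G.probParams := by
  rw [ae_iff, ← Set.compl_def, Measure.bind_apply G.measurableSet_probParams.compl
    (G.drawParams ρ D).aemeasurable]
  simp only [fun c => show G.drawParams ρ D c G.probParamsᶜ = 0 from G.ae_drawParams ρ D c,
    lintegral_zero]

theorem bind_round (G : CausalDiagram Ω U) (ρ : G.Prior) {T : ℕ} (D : Fin T → (v : V) → Ω v)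
    (ν : Measure G.Params) :
    ν.bind (G.round ρ D) = (ν.bind (G.drawExo D)).bind (G.drawParams ρ D) :=
  Measure.comp_assoc.symm

theorem ae_bind_round (G : CausalDiagram Ω U) (ρ : G.Prior) {T : ℕ} (D : Fin T → (v : V) → Ω v)
    (ν : Measure G.Params) : ∀ᵐ θ ∂ν.bind (G.round ρ D), θ ∈ G.probParams := by
  rw [bind_round]
  exact G.ae_bind_drawParams ρ D _

theorem isProbabilityMeasure_round {G : CausalDiagram Ω U} (ρ : G.Prior) {T : ℕ}
    (D : Fin T → (v : V) → Ω v) {θ : G.Params} (hθ : θ ∈ G.probParams) :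
    IsProbabilityMeasure (G.round ρ D θ) := by
  have := isProbabilityMeasure_drawExo D hθ
  rw [round, Kernel.comp_apply]
  infer_instance

theorem ae_round (G : CausalDiagram Ω U) (ρ : G.Prior) {T : ℕ} (D : Fin T → (v : V) → Ω v)
    (θ : G.Params) : ∀ᵐ θ' ∂G.round ρ D θ, θ' ∈ G.probParams := by
  rw [round, Kernel.comp_apply]
  exact G.ae_bind_drawParams ρ D _

/-! Invariance of the posterior. -/

theorem posterior_bind_drawExo_singleton (G : CausalDiagram Ω U) (ρ : G.Prior) {T : ℕ}
    (D : Fin T → (v : V) → Ω v) (c : G.Config T) :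
    (G.posterior ρ D).bind (G.drawExo D) {c} =
      (G.evidence ρ D)⁻¹ * ∫⁻ θ, ENNReal.ofReal (G.jointProb D c θ) ∂G.priorLaw ρ := by
  rw [Measure.bind_apply (measurableSet_singleton c) (G.drawExo D).aemeasurable, posterior,
    lintegral_smul_measure, smul_eq_mul,
    lintegral_withDensity_eq_lintegral_mul _ (G.measurable_likelihood D)
      ((G.drawExo D).measurable_coe (measurableSet_singleton c))]
  congr 1
  refine lintegral_congr_ae ?_
  filter_upwards [G.ae_priorLaw ρ] with θ hθ
  rw [Pi.mul_apply, drawExo_singleton, likelihood, ← ENNReal.ofReal_mul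
    (Finset.prod_nonneg fun t _ => obsProb_nonneg (exoProb_nonneg hθ) _),
    prod_obsProb_mul_prod_condExo (exoProb_nonneg hθ)]

/-- Drawing `c` from the posterior produces the marginal of the joint law, and `drawParams` is the
conditional law given `c`; hence the round reproduces the other marginal. -/
theorem posterior_bind_round (G : CausalDiagram Ω U) (ρ : G.Prior) {T : ℕ}
    (D : Fin T → (v : V) → Ω v) :
    (G.posterior ρ D).bind (G.round ρ D) = G.posterior ρ D := by
  have hjoint : ∀ c, (∫⁻ θ, ENNReal.ofReal (G.jointProb D c θ) ∂G.priorLaw ρ) •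
      G.drawParams ρ D c =
        (G.priorLaw ρ).withDensity fun θ => ENNReal.ofReal (G.jointProb D c θ) := by
    intro c
    obtain ⟨a, ha⟩ := G.exists_priorLaw_withDensity ρ D c
    -- As `drawParams` has mass one, comparing total masses identifies the unknown constant.
    have h := congrArg (fun m => m Set.univ) ha
    simp only [withDensity_apply _ MeasurableSet.univ, Measure.restrict_univ, Measure.smul_apply,
      measure_univ, smul_eq_mul, mul_one] at h
    rw [h, ha]
  rw [bind_round, Measure.bind_fintype]
  simp only [posterior_bind_drawExo_singleton, mul_smul, hjoint, ← Finset.smul_sum]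
  rw [posterior]
  congr 1
  ext s hs
  rw [Measure.coe_finsetSum, Finset.sum_apply]
  simp only [withDensity_apply _ hs]
  rw [← lintegral_finsetSum _ fun c _ => (G.measurable_jointProb D c).ennreal_ofReal]
  refine lintegral_congr_ae (ae_restrict_of_ae ?_)
  filter_upwards [G.ae_priorLaw ρ] with θ hθ
  rw [likelihood, ← sum_jointProb, ENNReal.ofReal_sum_of_nonneg fun c _ =>
    jointProb_nonneg (exoProb_nonneg hθ) D c]

/-! The outputs of the sampler. -/

theorem outputs_succ (G : CausalDiagram Ω U) (ρ : G.Prior) {T : ℕ} (D : Fin T → (v : V) → Ω v)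
    (μ : CtfMeasure Ω) (N : ℕ) (θ : G.Params) : G.outputs ρ D μ (N + 1) θ =
      (G.round ρ D θ).bind fun θ' =>
        (G.outputs ρ D μ N θ').map (Fin.cons (α := fun _ => ℝ) (G.ctfValue μ θ')) := rfl

theorem measurable_cons_real (N : ℕ) :
    Measurable fun p : ℝ × (Fin N → ℝ) => Fin.cons (α := fun _ => ℝ) p.1 p.2 := by
  refine measurable_pi_lambda _ fun k => ?_
  induction k using Fin.cases with
  | zero => simpa using measurable_fst
  | succ k => simp only [Fin.cons_succ]; fun_prop

/-- Both the measure and the map depend on `a`; pushing forward the product of the identity kernel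
with `κ` gives joint measurability. -/
theorem exists_kernel_map_cons {α : Type*} [MeasurableSpace α] {N : ℕ}
    (κ : Kernel α (Fin N → ℝ)) [IsSFiniteKernel κ] {h : α → ℝ} (hh : Measurable h) :
    ∃ η : Kernel α (Fin (N + 1) → ℝ), IsSFiniteKernel η ∧
      ∀ a, η a = (κ a).map (Fin.cons (α := fun _ => ℝ) (h a)) := by
  have hm : Measurable fun p : α × (Fin N → ℝ) => Fin.cons (α := fun _ => ℝ) (h p.1) p.2 :=
    (measurable_cons_real N).comp ((hh.comp measurable_fst).prodMk measurable_snd)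
  refine ⟨(Kernel.id ×ₖ κ).map fun p => Fin.cons (α := fun _ => ℝ) (h p.1) p.2,
    inferInstance, fun a => ?_⟩
  rw [Kernel.map_apply _ hm, Kernel.prod_apply, Kernel.id_apply, Measure.dirac_prod,
    Measure.map_map hm measurable_prodMk_left]
  rfl

theorem exists_kernel_outputs (G : CausalDiagram Ω U) (ρ : G.Prior) {T : ℕ}
    (D : Fin T → (v : V) → Ω v) (μ : CtfMeasure Ω) (N : ℕ) :
    ∃ κ : Kernel G.Params (Fin N → ℝ), IsSFiniteKernel κ ∧ ∀ θ, κ θ = G.outputs ρ D μ N θ := by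
  induction N with
  | zero => exact ⟨Kernel.const _ (Measure.dirac Fin.elim0), inferInstance, fun θ => rfl⟩
  | succ N ih =>
    obtain ⟨κ, hκ, hκo⟩ := ih
    obtain ⟨η, hη, hηo⟩ := exists_kernel_map_cons κ (G.measurable_ctfValue μ)
    refine ⟨η ∘ₖ G.round ρ D, inferInstance, fun θ => ?_⟩
    rw [Kernel.comp_apply, outputs_succ]
    congr 1
    funext θ'
    rw [hηo, hκo]

theorem measurable_outputs (G : CausalDiagram Ω U) (ρ : G.Prior) {T : ℕ}
    (D : Fin T → (v : V) → Ω v) (μ : CtfMeasure Ω) (N : ℕ) : Measurable (G.outputs ρ D μ N) := by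
  obtain ⟨κ, -, hκ⟩ := G.exists_kernel_outputs ρ D μ N
  rw [← show ⇑κ = G.outputs ρ D μ N from funext hκ]
  exact κ.measurable

theorem measurable_map_cons_outputs (G : CausalDiagram Ω U) (ρ : G.Prior) {T : ℕ}
    (D : Fin T → (v : V) → Ω v) (μ : CtfMeasure Ω) (N : ℕ) : Measurable fun θ =>
      (G.outputs ρ D μ N θ).map (Fin.cons (α := fun _ => ℝ) (G.ctfValue μ θ)) := by
  obtain ⟨κ, _, hκ⟩ := G.exists_kernel_outputs ρ D μ N
  obtain ⟨η, -, hη⟩ := exists_kernel_map_cons κ (G.measurable_ctfValue μ)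
  simp only [← hκ, ← hη]
  exact η.measurable

theorem measurable_cons_const {N : ℕ} (x : ℝ) :
    Measurable (Fin.cons (α := fun _ => ℝ) x : (Fin N → ℝ) → Fin (N + 1) → ℝ) :=
  (measurable_cons_real N).comp measurable_prodMk_left

theorem isProbabilityMeasure_outputs {G : CausalDiagram Ω U} (ρ : G.Prior) {T : ℕ}
    (D : Fin T → (v : V) → Ω v) (μ : CtfMeasure Ω) (N : ℕ) {θ : G.Params}
    (hθ : θ ∈ G.probParams) : IsProbabilityMeasure (G.outputs ρ D μ N θ) := by
  induction N generalizing θ with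
  | zero => exact Measure.dirac.isProbabilityMeasure
  | succ N ih =>
    have := isProbabilityMeasure_round ρ D hθ
    rw [outputs_succ]
    refine isProbabilityMeasure_bind_of_ae (G.measurable_map_cons_outputs ρ D μ N).aemeasurable ?_
    filter_upwards [G.ae_round ρ D θ] with θ' hθ'
    have := ih hθ'
    exact Measure.isProbabilityMeasure_map (measurable_cons_const _).aemeasurable

theorem afterRounds_succ' (G : CausalDiagram Ω U) (ρ : G.Prior) {T : ℕ}
    (D : Fin T → (v : V) → Ω v) (ν : Measure G.Params) (m : ℕ) :
    G.afterRounds ρ D ν (m + 1) = G.afterRounds ρ D (ν.bind (G.round ρ D)) m := by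
  induction m with
  | zero => rfl
  | succ m ih => rw [afterRounds, ih]; rfl

theorem isProbabilityMeasure_afterRounds (G : CausalDiagram Ω U) (ρ : G.Prior) {T : ℕ}
    (D : Fin T → (v : V) → Ω v) {ν : Measure G.Params} (hν : IsProbabilityMeasure ν)
    (hp : ∀ᵐ θ ∂ν, θ ∈ G.probParams) (m : ℕ) :
    IsProbabilityMeasure (G.afterRounds ρ D ν m) ∧
      ∀ᵐ θ ∂G.afterRounds ρ D ν m, θ ∈ G.probParams := by
  induction m with
  | zero => exact ⟨hν, hp⟩
  | succ m ih =>
    have := ih.1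
    exact ⟨isProbabilityMeasure_bind_of_ae (G.round ρ D).aemeasurable
      (ih.2.mono fun θ hθ => isProbabilityMeasure_round ρ D hθ), G.ae_bind_round ρ D _⟩

theorem map_bind_of_measurable {α β γ : Type*} [MeasurableSpace α] [MeasurableSpace β]
    [MeasurableSpace γ] (ν : Measure α) {κ : α → Measure β} (hκ : Measurable κ) {g : β → γ}
    (hg : Measurable g) : (ν.bind κ).map g = ν.bind fun a => (κ a).map g := by
  ext s hs
  rw [Measure.map_apply hg hs, Measure.bind_apply (hg hs) hκ.aemeasurable,
    Measure.bind_apply (f := fun a => (κ a).map g) hs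
      ((Measure.measurable_map g hg).comp hκ).aemeasurable]
  exact lintegral_congr fun a => (Measure.map_apply hg hs).symm

/-- The `j`-th output is the value of `μ` after `j + 1` rounds. -/
theorem bind_outputs_map (G : CausalDiagram Ω U) (ρ : G.Prior) {T : ℕ}
    (D : Fin T → (v : V) → Ω v) (μ : CtfMeasure Ω) (N : ℕ) (j : Fin N) (ν : Measure G.Params) :
    (ν.bind (G.outputs ρ D μ N)).map (fun x => x j) =
      (G.afterRounds ρ D ν (j + 1)).map (G.ctfValue μ) := by
  induction N generalizing ν with
  | zero => exact j.elim0
  | succ N ih =>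
    have hb : ν.bind (G.outputs ρ D μ (N + 1)) = (ν.bind (G.round ρ D)).bind fun θ' =>
        (G.outputs ρ D μ N θ').map (Fin.cons (α := fun _ => ℝ) (G.ctfValue μ θ')) :=
      (Measure.bind_bind (G.round ρ D).aemeasurable
        (G.measurable_map_cons_outputs ρ D μ N).aemeasurable).symm
    have hmap : ∀ θ' : G.Params, ((G.outputs ρ D μ N θ').map
        (Fin.cons (α := fun _ => ℝ) (G.ctfValue μ θ'))).map (fun x => x j) =
        (G.outputs ρ D μ N θ').map fun x => Fin.cons (α := fun _ => ℝ) (G.ctfValue μ θ') x j :=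
      fun θ' => Measure.map_map (measurable_pi_apply j) (measurable_cons_const _)
    rw [hb, map_bind_of_measurable _ (G.measurable_map_cons_outputs ρ D μ N)
      (measurable_pi_apply j)]
    simp only [hmap]
    -- For the first output the later ones integrate out, their law having mass one almost
    -- everywhere; otherwise the induction hypothesis applies to the law after one round.
    induction j using Fin.cases with
    | zero =>
      simp only [Fin.cons_zero, Measure.map_const]
      rw [Measure.bind_congr_right (g := fun θ' => Measure.dirac (G.ctfValue μ θ'))]
      · exact Measure.bind_dirac_eq_map _ (G.measurable_ctfValue μ)
      · filter_upwards [G.ae_bind_round ρ D ν] with θ' hθ'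
        have := isProbabilityMeasure_outputs ρ D μ N hθ'
        simp
    | succ j =>
      simp only [Fin.cons_succ, Fin.val_succ]
      rw [afterRounds_succ', ← ih j, map_bind_of_measurable _ (G.measurable_outputs ρ D μ N)
        (measurable_pi_apply j)]

theorem afterRounds_add (G : CausalDiagram Ω U) (ρ : G.Prior) {T : ℕ}
    (D : Fin T → (v : V) → Ω v) (ν : Measure G.Params) (m n : ℕ) :
    G.afterRounds ρ D (G.afterRounds ρ D ν m) n = G.afterRounds ρ D ν (m + n) := by
  induction n with
  | zero => rfl
  | succ n ih => rw [afterRounds, ih]; rfl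

theorem run_map (G : CausalDiagram Ω U) (ρ : G.Prior) {T : ℕ} (D : Fin T → (v : V) → Ω v)
    (μ : CtfMeasure Ω) (ν : Measure G.Params) (M N : ℕ) (j : Fin N) :
    (G.run ρ D μ ν M N).map (fun x => x j) =
      (G.afterRounds ρ D ν (M + j + 1)).map (G.ctfValue μ) := by
  rw [run, bind_outputs_map, afterRounds_add, add_assoc]

theorem isProbabilityMeasure_run (G : CausalDiagram Ω U) (ρ : G.Prior) {T : ℕ}
    (D : Fin T → (v : V) → Ω v) (μ : CtfMeasure Ω) {ν : Measure G.Params}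
    (hν : IsProbabilityMeasure ν) (hp : ∀ᵐ θ ∂ν, θ ∈ G.probParams) (M N : ℕ) :
    IsProbabilityMeasure (G.run ρ D μ ν M N) := by
  obtain ⟨h1, h2⟩ := G.isProbabilityMeasure_afterRounds ρ D hν hp M
  exact isProbabilityMeasure_bind_of_ae (G.measurable_outputs ρ D μ N).aemeasurable
    (h2.mono fun θ hθ => isProbabilityMeasure_outputs ρ D μ N hθ)

theorem afterRounds_posterior (G : CausalDiagram Ω U) (ρ : G.Prior) {T : ℕ}
    (D : Fin T → (v : V) → Ω v) (m : ℕ) :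
    G.afterRounds ρ D (G.posterior ρ D) m = G.posterior ρ D := by
  induction m with
  | zero => rfl
  | succ m ih => rw [afterRounds, ih, posterior_bind_round]

/-! The initialization. -/

theorem measurable_init (G : CausalDiagram Ω U) {T : ℕ} (D : Fin T → (v : V) → Ω v) :
    Measurable fun z : G.Config T × G.Fns =>
      ((fun i _ => ((G.d i + 1 : ℕ) : ℝ)⁻¹, G.matchData D z.1 z.2) : G.Params) :=
  measurable_const.prodMk Measurable.of_discrete

theorem isProbabilityMeasure_initLaw (G : CausalDiagram Ω U) (ρ : G.Prior) {T : ℕ}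
    (D : Fin T → (v : V) → Ω v) : IsProbabilityMeasure (G.initLaw ρ D) :=
  Measure.isProbabilityMeasure_map (G.measurable_init D).aemeasurable

theorem ae_initLaw (G : CausalDiagram Ω U) (ρ : G.Prior) {T : ℕ} (D : Fin T → (v : V) → Ω v) :
    ∀ᵐ θ ∂G.initLaw ρ D, θ ∈ G.probParams := by
  refine (ae_map_iff (G.measurable_init D).aemeasurable G.measurableSet_probParams).2
    (.of_forall fun z i => ⟨fun k => by positivity, ?_⟩)
  have : ((G.d i + 1 : ℕ) : ℝ) ≠ 0 := by positivity
  rw [Finset.sum_const, Finset.card_univ, Fintype.card_fin, nsmul_eq_mul, mul_inv_cancel₀ this]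

/-! The chain of the exogenous values. -/

/-- The transition kernel of the exogenous values of the records. -/
noncomputable def exoStep (G : CausalDiagram Ω U) (ρ : G.Prior) {T : ℕ}
    (D : Fin T → (v : V) → Ω v) : Kernel (G.Config T) (G.Config T) :=
  G.drawExo D ∘ₖ G.drawParams ρ D

instance isMarkovKernel_exoStep (G : CausalDiagram Ω U) (ρ : G.Prior) {T : ℕ}
    (D : Fin T → (v : V) → Ω v) : IsMarkovKernel (G.exoStep ρ D) :=
  ⟨fun c => by
    rw [exoStep, Kernel.comp_apply]
    exact isProbabilityMeasure_bind_of_ae (G.drawExo D).aemeasurable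
      ((G.ae_drawParams ρ D c).mono fun θ hθ => isProbabilityMeasure_drawExo D hθ)⟩

/-- The transition matrix of the exogenous values of the records. -/
noncomputable def exoMatrix (G : CausalDiagram Ω U) (ρ : G.Prior) {T : ℕ}
    (D : Fin T → (v : V) → Ω v) : Matrix (G.Config T) (G.Config T) ℝ :=
  Matrix.of fun c c' => (G.exoStep ρ D c).real {c'}

theorem exoMatrix_nonneg (G : CausalDiagram Ω U) (ρ : G.Prior) {T : ℕ}
    (D : Fin T → (v : V) → Ω v) (c c' : G.Config T) : 0 ≤ G.exoMatrix ρ D c c' :=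
  measureReal_nonneg

theorem sum_real_singleton {α : Type*} [MeasurableSpace α] [Fintype α] [MeasurableSingletonClass α]
    (ν : Measure α) [IsProbabilityMeasure ν] : ∑ a, ν.real {a} = 1 := by
  rw [sum_measureReal_singleton, Finset.coe_univ, probReal_univ]

theorem real_bind_fintype {α β : Type*} [MeasurableSpace α] [MeasurableSpace β] [Fintype α]
    [DiscreteMeasurableSpace α] (ν : Measure α) [IsFiniteMeasure ν] (κ : Kernel α β)
    [IsMarkovKernel κ] (s : Set β) : (ν.bind κ).real s = ∑ a, ν.real {a} * (κ a).real s := by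
  rw [Measure.bind_fintype, measureReal_def, Measure.coe_finsetSum, Finset.sum_apply,
    ENNReal.toReal_sum fun a _ => by
      rw [Measure.smul_apply, smul_eq_mul]
      exact ENNReal.mul_ne_top (measure_ne_top _ _) (measure_ne_top _ _)]
  simp [measureReal_def]

/-- The drawn functions equal `matchData D c f₀` with positive probability. A record they cannot
produce at all triggers the uniform fallback, which charges every unit. -/
theorem exoMatrix_pos_of_exists (G : CausalDiagram Ω U) (ρ : G.Prior) {T : ℕ}
    {D : Fin T → (v : V) → Ω v} {c c' : G.Config T} (f₀ : G.Fns)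
    (h : ∀ t, G.obs (G.matchData D c f₀) (c' t) = D t ∨
      ∀ u, G.obs (G.matchData D c f₀) u ≠ D t) : 0 < G.exoMatrix ρ D c c' := by
  refine ENNReal.toReal_pos (fun h0 => ?_) (measure_ne_top _ _)
  rw [exoStep, Kernel.comp_apply, Measure.bind_apply (measurableSet_singleton _)
    (G.drawExo D).aemeasurable, lintegral_eq_zero_iff
    ((G.drawExo D).measurable_coe (measurableSet_singleton _))] at h0
  have hf : (G.fnLaw ρ).map (G.matchData D c) {G.matchData D c f₀} ≠ 0 := by
    rw [Measure.map_apply Measurable.of_discrete (measurableSet_singleton _)]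
    exact fun h => G.fnLaw_singleton_ne_zero ρ f₀
      (measure_mono_null (Set.singleton_subset_iff.2 (Set.mem_singleton (G.matchData D c f₀))) h)
  refine G.prod_dirichlet_pos_ne_zero (G.counts ρ c) (G.counts_pos ρ c) _ _ hf
    (measure_mono_null (fun θ hθ => ?_) h0)
  obtain ⟨hpos, hθf⟩ := hθ
  rw [← hθf] at h
  have hnn : ∀ u, 0 ≤ G.exoProb θ u := fun u => (exoProb_pos hpos u).le
  have : 0 < ∏ t, G.condExo θ (D t) (c' t) := by
    refine Finset.prod_pos fun t _ => ?_
    rw [condExo]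
    rcases h t with ht | ht
    · have h1 : 0 < G.obsProb θ (D t) := (exoProb_pos hpos _).trans_le (exoProb_le_obsProb hnn ht)
      rw [if_neg h1.ne', if_pos ht]
      exact div_pos (exoProb_pos hpos _) h1
    · have h1 : G.obsProb θ (D t) = 0 := by
        rw [obsProb_eq]
        exact Finset.sum_eq_zero fun u _ => if_neg (ht u)
      have : Nonempty G.ExVal := ⟨fun _ => 0⟩
      rw [if_pos h1]
      positivity
  simpa [drawExo_singleton] using this

theorem exoMatrix_pos_of_joined (G : CausalDiagram Ω U) (ρ : G.Prior) {T : ℕ}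
    {D : Fin T → (v : V) → Ω v} {c c' : G.Config T} (h : G.Joined D c c') :
    0 < G.exoMatrix ρ D c c' := by
  obtain ⟨g, hg, hg'⟩ := h
  exact G.exoMatrix_pos_of_exists ρ g fun t => Or.inl (by rw [hg.matchData_eq]; exact hg' t)

/-- Arbitrary `c` must be treated, since the fallback can assign incompatible values; one step
repairs them, and relabelings do the rest. -/
theorem exists_reflTransGen_exoMatrix (G : CausalDiagram Ω U) (ρ : G.Prior) {T : ℕ}
    {D : Fin T → (v : V) → Ω v} (hD : G.Possible D) :
    ∃ k, 0 < G.exoMatrix ρ D k k ∧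
      ∀ c, Relation.ReflTransGen (fun c c' => 0 < G.exoMatrix ρ D c c') c k := by
  obtain ⟨e, he⟩ := G.exists_injective_local
  obtain ⟨f₀⟩ := G.nonempty_fns ρ
  refine ⟨G.localConfig D e, G.exoMatrix_pos_of_joined ρ ?_, fun c => ?_⟩
  · obtain ⟨f, hf⟩ := (compat_localConfig_of_injective hD he).exists_matches f₀
    exact ⟨f, hf, hf⟩
  · obtain ⟨b, hb, hbf⟩ := exists_compat_localConfig hD (G.matchData D c f₀) fun v hv t e => by
      have hempty : IsEmpty (G.ex v) := by rw [hv]; infer_instance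
      -- Without exogenous parents, record `t` hits this argument whatever `c` is, so the value
      -- comes from the data and `Possible` makes it the right one.
      rcases G.matchData_apply D c f₀ v (fun p => D t p) e with ⟨s, hs, h⟩ | ⟨hn, -⟩
      · rw [h]
        exact hD v hv s t fun p hp => (hs.1 ⟨p, hp⟩).symm
      · exact absurd ⟨fun _ => rfl, fun i => hempty.elim i⟩ (hn t)
    exact .head (G.exoMatrix_pos_of_exists ρ f₀ hbf)
      (Relation.ReflTransGen.mono (fun _ _ => G.exoMatrix_pos_of_joined ρ)
        _ _ (reflTransGen_joined f₀ hb he))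

/-- The law of the exogenous values after `m` steps from the law `ν`. -/
noncomputable def exoLaw (G : CausalDiagram Ω U) (ρ : G.Prior) {T : ℕ}
    (D : Fin T → (v : V) → Ω v) (ν : Measure (G.Config T)) : ℕ → Measure (G.Config T)
  | 0 => ν
  | m + 1 => (G.exoLaw ρ D ν m).bind (G.exoStep ρ D)

/-- The half-steps are regrouped: `m + 1` rounds contain only `m` steps of the finite chain, between
a first `drawExo` and a last `drawParams`. -/
theorem afterRounds_succ_eq (G : CausalDiagram Ω U) (ρ : G.Prior) {T : ℕ}
    (D : Fin T → (v : V) → Ω v) (ν : Measure G.Params) (m : ℕ) :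
    G.afterRounds ρ D ν (m + 1) =
      (G.exoLaw ρ D (ν.bind (G.drawExo D)) m).bind (G.drawParams ρ D) := by
  induction m with
  | zero => exact G.bind_round ρ D ν
  | succ m ih =>
    rw [afterRounds, ih, bind_round, exoLaw, exoStep]
    congr 1
    exact Measure.comp_assoc

theorem exoLaw_real (G : CausalDiagram Ω U) (ρ : G.Prior) {T : ℕ}
    (D : Fin T → (v : V) → Ω v) (ν : Measure (G.Config T)) [IsProbabilityMeasure ν] (m : ℕ) :
    IsProbabilityMeasure (G.exoLaw ρ D ν m) ∧ (fun c => (G.exoLaw ρ D ν m).real {c}) =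
      Matrix.vecMul (fun c => ν.real {c}) (G.exoMatrix ρ D ^ m) := by
  induction m with
  | zero => exact ⟨by rw [exoLaw]; infer_instance, by simp [exoLaw]⟩
  | succ m ih =>
    obtain ⟨h1, h2⟩ := ih
    refine ⟨by rw [exoLaw]; infer_instance, ?_⟩
    rw [pow_succ, ← Matrix.vecMul_vecMul, ← h2]
    funext c
    rw [exoLaw, real_bind_fintype]
    rfl

theorem isProbabilityMeasure_bind_drawExo (G : CausalDiagram Ω U) {T : ℕ}
    (D : Fin T → (v : V) → Ω v) {ν : Measure G.Params} (hν : IsProbabilityMeasure ν)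
    (hp : ∀ᵐ θ ∂ν, θ ∈ G.probParams) : IsProbabilityMeasure (ν.bind (G.drawExo D)) :=
  isProbabilityMeasure_bind_of_ae (G.drawExo D).aemeasurable
    (hp.mono fun _ hθ => isProbabilityMeasure_drawExo D hθ)

/-- The law of the parameters converges to the posterior in total variation. -/
theorem exists_afterRounds_sub_posterior_le (G : CausalDiagram Ω U) (ρ : G.Prior) {T : ℕ}
    {D : Fin T → (v : V) → Ω v} (hD : G.Possible D) {ν : Measure G.Params}
    (hν : IsProbabilityMeasure ν) (hp : ∀ᵐ θ ∂ν, θ ∈ G.probParams) {ε : ℝ} (hε : 0 < ε) :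
    ∃ M₀ : ℕ, ∀ m ≥ M₀, ∀ s : Set G.Params,
      |(G.afterRounds ρ D ν (m + 1)).real s - (G.posterior ρ D).real s| ≤ ε := by
  have hpost := G.isProbabilityMeasure_posterior ρ hD
  have hν' := G.isProbabilityMeasure_bind_drawExo D hν hp
  have hπ' := G.isProbabilityMeasure_bind_drawExo D hpost (G.ae_posterior ρ D)
  set ν₀ := ν.bind (G.drawExo D)
  set π := (G.posterior ρ D).bind (G.drawExo D) with hπ
  have hπp : π.bind (G.drawParams ρ D) = G.posterior ρ D := by
    rw [hπ, ← bind_round, posterior_bind_round]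
  have hπstep : π.bind (G.exoStep ρ D) = π := by
    rw [exoStep, ← Measure.comp_assoc, hπp]
  have hinv : Matrix.vecMul (fun c => π.real {c}) (G.exoMatrix ρ D) = fun c => π.real {c} := by
    funext c
    conv_rhs => rw [← hπstep, real_bind_fintype]
    rfl
  obtain ⟨k, hk, hreach⟩ := G.exists_reflTransGen_exoMatrix ρ hD
  obtain ⟨M₀, hM₀⟩ := (G.exoMatrix ρ D).exists_sum_abs_vecMul_pow_sub_le (G.exoMatrix_nonneg ρ D)
    (fun c => sum_real_singleton _) k hk hreach (fun c => π.real {c}) (sum_real_singleton π)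
    hinv (fun c => ν₀.real {c}) (sum_real_singleton ν₀) hε
  refine ⟨M₀, fun m hm s => le_trans ?_ (hM₀ m hm)⟩
  obtain ⟨hprob, hreal⟩ := G.exoLaw_real ρ D ν₀ m
  rw [afterRounds_succ_eq, ← hπp, real_bind_fintype, real_bind_fintype, ← Finset.sum_sub_distrib,
    ← hreal]
  -- Both laws are mixtures of the same `drawParams c`, so they differ on `s` by at most the `ℓ¹`
  -- distance of the weights.
  refine (Finset.abs_sum_le_sum_abs _ _).trans (Finset.sum_le_sum fun c _ => ?_)
  rw [← sub_mul, abs_mul, abs_of_nonneg (measureReal_nonneg (μ := G.drawParams ρ D c))]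
  exact mul_le_of_le_one_right (abs_nonneg _) measureReal_le_one

end CausalDiagram

/-- The posterior is well defined; a run started from the posterior outputs exact posterior samples;
and the outputs of the procedure converge in total variation to the posterior as the burn-in grows. -/
theorem theorem2 {V U : Type*} [Fintype V] [DecidableEq V] [Fintype U] [DecidableEq U]
    {Ω : V → Type*} [∀ v, Fintype (Ω v)] [∀ v, DecidableEq (Ω v)]
    [∀ v, MeasurableSpace (Ω v)] [∀ v, DiscreteMeasurableSpace (Ω v)]
    (G : CausalDiagram Ω U) (ρ : G.Prior) {T : ℕ} (D : Fin T → (v : V) → Ω v)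
    (hD : G.Possible D) (μ : CtfMeasure Ω) :
    (G.evidence ρ D ≠ 0 ∧ IsProbabilityMeasure (G.posterior ρ D) ∧
      IsProbabilityMeasure (G.posteriorCtf ρ D μ)) ∧
    ((G.posterior ρ D).bind (G.round ρ D) = G.posterior ρ D ∧
      ∀ (M N : ℕ) (j : Fin N),
        (G.run ρ D μ (G.posterior ρ D) M N).map (fun x => x j) = G.posteriorCtf ρ D μ) ∧
    ((∀ M N : ℕ, IsProbabilityMeasure (G.sampleCTF ρ D μ M N)) ∧
      ∀ ε : ℝ, 0 < ε → ∃ M₀ : ℕ, ∀ M ≥ M₀, ∀ (N : ℕ) (j : Fin N) (A : Set ℝ), MeasurableSet A →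
        |((G.sampleCTF ρ D μ M N).map (fun x => x j)).real A - (G.posteriorCtf ρ D μ).real A|
          ≤ ε) := by
  have hpost := G.isProbabilityMeasure_posterior ρ hD
  have hμ := G.measurable_ctfValue μ
  refine ⟨⟨G.evidence_ne_zero ρ hD, hpost, Measure.isProbabilityMeasure_map hμ.aemeasurable⟩,
    ⟨G.posterior_bind_round ρ D, fun M N j => ?_⟩,
    ⟨G.isProbabilityMeasure_run ρ D μ (G.isProbabilityMeasure_initLaw ρ D) (G.ae_initLaw ρ D),
      fun ε hε => ?_⟩⟩
  · rw [G.run_map, G.afterRounds_posterior]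
    rfl
  · obtain ⟨M₀, hM₀⟩ := G.exists_afterRounds_sub_posterior_le ρ hD
      (G.isProbabilityMeasure_initLaw ρ D) (G.ae_initLaw ρ D) hε
    refine ⟨M₀, fun M hM N j A hA => ?_⟩
    rw [CausalDiagram.sampleCTF, G.run_map, CausalDiagram.posteriorCtf,
      map_measureReal_apply hμ hA, map_measureReal_apply hμ hA]
    -- Output `j` is read after `M + j + 1` rounds, so one threshold for `M` serves all `N` and `j`.
    exact hM₀ (M + j) (by omega) _
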